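/- Let $d\ge 1$. Let $\Omega\subset\mathbb R^d$ be a bounded Lipschitz domain whose boundary is the disjoint union of measurable parts $\Gamma_D,\Gamma_N,\Gamma_R$ with $|\Gamma_R|>0$, and let $\kappa>0$. All functions are complex valued. Let $H^1_{0,\Gamma_D}(\Omega)$ be the space of $H^1(\Omega)$-functions with zero trace on $\Gamma_D$, let $U:=L_2(\Omega)\times L_2(\Omega)^d$ with its canonical norm, and, for either choice of the sign, $$V_\mp:=\Big\{(\eta,\vec v)\in H^1_{0,\Gamma_D}(\Omega)\times H(\mathrm{div};\Omega):\ \int_{\partial\Omega}\vec v\cdot\vec n\,\overline\psi\,ds\mp i\int_{\Gamma_R}\eta\,\overline\psi\,ds=0\ \ \forall \psi\in H^1_{0,\Gamma_D}(\Omega)\Big\},$$ where the first integral is the duality pairing $\int_\Omega \vec v\cdot\nabla\overline\psi+\mathrm{div}\,\vec v\,\overline\psi\,dx$. Put $$(B_\kappa(\phi,\vec u))(\eta,\vec v):=\int_\Omega \tfrac1\kappa\vec u\cdot\nabla\overline\eta-\phi\overline\eta-\tfrac1\kappa\phi\,\mathrm{div}\,\overline{\vec v}-\vec u\cdot\overline{\vec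 v}\,dx ,$$ $$\|(\eta,\vec v)\|_{V_{\mp},\kappa}:=\big\|\big(-\tfrac1\kappa\mathrm{div}\,\vec v-\eta,\ \tfrac1\kappa\nabla\eta-\vec v\big)\big\|_U .$$ Let $\mathcal T^\delta$ be a conforming subdivision of $\Omega$ into $d$-simplices (finitely many non-degenerate closed simplices with union $\overline\Omega$, any two of which intersect in the possibly empty face spanned by their common vertices). Let $\mathcal T^\delta$ be shape regular with constant $\sigma$, i.e., each $K\in\mathcal T^\delta$ contains a ball of some diameter $\rho>0$ with $\mathrm{diam}(K)\le\sigma\rho$. Put $h_{\delta,\min}:=\min_{K\in\mathcal T^\delta}|K|^{1/d}$. For $k\in\mathbb N_0$ let $P_k(K)$ be the polynomials of total degree at most $k$ on $K$, $\widetilde P_k(K)$ the homogeneous polynomials of degree $k$ (together with $0$), and $$\mathcal S_k^{-1}(\mathcal T^\delta):=\{v\in L_2(\Omega): v|_K\in P_k(K)\ (K\in\mathcal T^\delta)\},\qquad \mathcal S_k^0(\mathcal T^\delta):=\mathcal S_k^{-1}(\mathcal T^\delta)\cap C(\overline\Omega),$$ $$RT_k(\mathcal T^\delta):=\{\vec v\in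 H(\mathrm{div};\Omega): \vec v|_K\in P_k(K)^d+\vec x\,\widetilde P_k(K)\ (K\in\mathcal T^\delta)\}.$$ For $p\in\mathbb N_0$ let $$U^\delta:=\mathcal S_p^{-1}(\mathcal T^\delta)^{d+1},\qquad V_\mp^\delta:=\big(\mathcal S^0_{p+d+1}(\mathcal T^\delta)\times RT_{p+1}(\mathcal T^\delta)\big)\cap V_\mp,$$ $$\gamma_\kappa^\delta:=\inf_{0\ne \mathbf{u}\in U^\delta}\ \sup_{0\neq \mathbf{v}\in V_\mp^\delta}\frac{|(B_\kappa \mathbf{u})(\mathbf{v})|}{\|\mathbf{u}\|_U\,\|\mathbf{v}\|_{V_\mp,\kappa}} .$$ Then there are constants $C>0$ and $c>0$, depending only on $d$, $\sigma$ and $p$ (so not on $\Omega$, $\Gamma_D,\Gamma_N,\Gamma_R$, $\mathcal T^\delta$, $\kappa$, or the sign), such that $$\kappa\,h_{\delta,\min}\ge C\quad\Longrightarrow\quad \gamma_\kappa^\delta\ge c .$$ -/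

import Mathlib

open MeasureTheory Filter Topology
open scoped ContDiff

namespace Helmholtz

/-- The ambient Euclidean space of dimension `d`. -/
abbrev Eucl (d : ℕ) : Type := EuclideanSpace ℝ (Fin d)

/-- Values of complex vector fields. -/
abbrev CVec (d : ℕ) : Type := EuclideanSpace ℂ (Fin d)

variable {d : ℕ}

/-! ### Domains -/

/-- A bounded Lipschitz domain: a bounded, connected (in particular non-empty) open set that, near
each of its boundary points, is the strict epigraph, in the direction of some unit vector `e`, of a
Lipschitz function `f` of the coordinates orthogonal to `e`. -/
structure IsBoundedLipschitzDomain (Ω : Set (Eucl d)) : Prop where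
  isOpen : IsOpen Ω
  isConnected : IsConnected Ω
  isBounded : Bornology.IsBounded Ω
  lipschitz : ∀ x ∈ frontier Ω, ∃ (e : Eucl d) (f : Eucl d → ℝ) (L : NNReal) (r : ℝ),
    ‖e‖ = 1 ∧ LipschitzWith L f ∧ (∀ (y : Eucl d) (t : ℝ), f (y + t • e) = f y) ∧ 0 < r ∧
      ∀ y ∈ Metric.ball x r, y ∈ Ω ↔ f y < inner ℝ e y

/-- The surface measure on subsets of the boundary of a domain: the `(d-1)`-dimensional Hausdorff
measure, normalized to agree with Lebesgue measure on hyperplanes. -/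
noncomputable abbrev surf (d : ℕ) : Measure (Eucl d) := μHE[d - 1]

/-- The boundary of `Ω` is the disjoint union of the measurable parts `ΓD`, `ΓN`, `ΓR`, carrying
Dirichlet, Neumann and Robin conditions, where the Robin part has positive surface measure. -/
structure IsBoundaryDecomposition (Ω ΓD ΓN ΓR : Set (Eucl d)) : Prop where
  measurable_D : MeasurableSet ΓD
  measurable_N : MeasurableSet ΓN
  measurable_R : MeasurableSet ΓR
  disjoint_DN : Disjoint ΓD ΓN
  disjoint_DR : Disjoint ΓD ΓR
  disjoint_NR : Disjoint ΓN ΓR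
  union_eq : ΓD ∪ ΓN ∪ ΓR = frontier Ω
  robin_pos : 0 < surf d ΓR

/-! ### Function spaces -/

/-- `L₂(Ω)`, complex valued. -/
noncomputable abbrev L2 (Ω : Set (Eucl d)) := Lp ℂ 2 (volume.restrict Ω)

/-- `L₂(Ω)^d`, complex valued. -/
noncomputable abbrev L2Vec (Ω : Set (Eucl d)) := Lp (CVec d) 2 (volume.restrict Ω)

/-- `U = L₂(Ω) × L₂(Ω)^d` with its Hilbert space norm `(‖φ‖² + ‖u‖²)^(1/2)`. -/
noncomputable abbrev USpace (Ω : Set (Eucl d)) := WithLp 2 (L2 Ω × L2Vec Ω)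

/-- Test functions: smooth with compact support contained in `Ω`. Real-valued ones suffice, by
linearity, to test complex-valued functions. -/
def IsTestFunction (Ω : Set (Eucl d)) (χ : Eucl d → ℝ) : Prop :=
  ContDiff ℝ ∞ χ ∧ HasCompactSupport χ ∧ tsupport χ ⊆ Ω

/-- The partial derivative `∂ᵢ χ`. -/
noncomputable def partialDeriv (i : Fin d) (χ : Eucl d → ℝ) (x : Eucl d) : ℝ :=
  fderiv ℝ χ x (EuclideanSpace.single i 1)

/-- `g` is the weak gradient of `η` on `Ω`. -/
def HasWeakGrad {Ω : Set (Eucl d)} (η : L2 Ω) (g : L2Vec Ω) : Prop :=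
  ∀ χ, IsTestFunction Ω χ → ∀ i : Fin d,
    ∫ x in Ω, η x * (partialDeriv i χ x : ℂ) = -∫ x in Ω, g x i * (χ x : ℂ)

/-- `w` is the weak divergence of `v` on `Ω`. -/
def HasWeakDiv {Ω : Set (Eucl d)} (v : L2Vec Ω) (w : L2 Ω) : Prop :=
  ∀ χ, IsTestFunction Ω χ →
    ∫ x in Ω, ∑ i : Fin d, v x i * (partialDeriv i χ x : ℂ) = -∫ x in Ω, w x * (χ x : ℂ)

/-- Membership in `H¹(Ω)`. -/
def MemH1 {Ω : Set (Eucl d)} (η : L2 Ω) : Prop := ∃ g, HasWeakGrad η g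

/-- Membership in `H(div; Ω)`. -/
def MemHdiv {Ω : Set (Eucl d)} (v : L2Vec Ω) : Prop := ∃ w, HasWeakDiv v w

open Classical in
/-- The weak gradient of an `H¹` function (it is unique), and `0` off `H¹`. -/
noncomputable def weakGrad {Ω : Set (Eucl d)} (η : L2 Ω) : L2Vec Ω :=
  if h : ∃ g, HasWeakGrad η g then h.choose else 0

open Classical in
/-- The weak divergence of an `H(div)` field (it is unique), and `0` off `H(div)`. -/
noncomputable def weakDiv {Ω : Set (Eucl d)} (v : L2Vec Ω) : L2 Ω :=
  if h : ∃ w, HasWeakDiv v w then h.choose else 0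

/-- `L₂(∂Ω)` with respect to the surface measure. -/
noncomputable abbrev L2Bdry (Ω : Set (Eucl d)) := Lp ℂ 2 ((surf d).restrict (frontier Ω))

/-- `g ∈ L₂(∂Ω)` is the trace of `η ∈ H¹(Ω)`. The trace operator is the continuous extension to
`H¹(Ω)`, with values in `L₂(∂Ω)`, of the restriction to `∂Ω` of functions in
`H¹(Ω) ∩ C(closure Ω)`. So `g` is the trace of `η` when there are `ηₙ` in that class that converge to
`η` in `H¹(Ω)` and whose boundary values converge to `g` in `L₂(∂Ω)`. -/
def IsTrace {Ω : Set (Eucl d)} (η : L2 Ω) (g : L2Bdry Ω) : Prop :=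
  MemH1 η ∧ ∃ (ηs : ℕ → L2 Ω) (fs : ℕ → Eucl d → ℂ),
    (∀ n, MemH1 (ηs n) ∧ ContinuousOn (fs n) (closure Ω) ∧ ηs n =ᵐ[volume.restrict Ω] fs n) ∧
    Tendsto ηs atTop (𝓝 η) ∧
    Tendsto (fun n => weakGrad (ηs n)) atTop (𝓝 (weakGrad η)) ∧
    Tendsto (fun n => eLpNorm (fun x => fs n x - g x) 2 ((surf d).restrict (frontier Ω)))
      atTop (𝓝 0)

/-- `η ∈ H¹(Ω)` has trace `g`, and this trace vanishes on `ΓD`; so `η ∈ H¹_{0,ΓD}(Ω)`. -/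
def IsTraceVanishingOn {Ω : Set (Eucl d)} (ΓD : Set (Eucl d)) (η : L2 Ω) (g : L2Bdry Ω) : Prop :=
  IsTrace η g ∧ ∀ᵐ x ∂((surf d).restrict (frontier Ω)), x ∈ ΓD → g x = 0

/-- The duality pairing `∫_{∂Ω} (v · n) conj ψ ds` of the normal trace of `v ∈ H(div; Ω)` with the
trace of `ψ ∈ H¹(Ω)`, defined by Green's formula as `∫_Ω v · conj (∇ψ) + (div v) conj ψ dx`. -/
noncomputable def normalPairing {Ω : Set (Eucl d)} (v : L2Vec Ω) (ψ : L2 Ω) : ℂ :=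
  ∫ x in Ω, (inner ℂ (weakGrad ψ x) (v x) + weakDiv v x * starRingEnd ℂ (ψ x))

/-- The space `V_∓`: pairs `(η, v) ∈ H¹_{0,ΓD}(Ω) × H(div; Ω)` with
`∫_{∂Ω} (v · n) conj ψ ds + s i ∫_{ΓR} η conj ψ ds = 0` for all `ψ ∈ H¹_{0,ΓD}(Ω)`. The sign
`s = -1` is the upper choice in `∓`, and `s = 1` the lower one. -/
def VSpace (Ω ΓD ΓR : Set (Eucl d)) (s : ℝ) : Set (L2 Ω × L2Vec Ω) :=
  {z | MemHdiv z.2 ∧ ∃ g : L2Bdry Ω, IsTraceVanishingOn ΓD z.1 g ∧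
    ∀ (ψ : L2 Ω) (h : L2Bdry Ω), IsTraceVanishingOn ΓD ψ h →
      normalPairing z.2 ψ
        + (s : ℂ) * Complex.I * ∫ x in ΓR, g x * starRingEnd ℂ (h x) ∂(surf d) = 0}

/-! ### The ultra-weak form, the optimal test norm and the inf-sup constant -/

/-- `(B_κ (φ, u)) (η, v) =
∫_Ω κ⁻¹ u · conj (∇η) - φ conj η - κ⁻¹ φ conj (div v) - u · conj v dx`. -/
noncomputable def ultraWeakForm {Ω : Set (Eucl d)} (κ : ℝ) (w : USpace Ω) (z : L2 Ω × L2Vec Ω) : ℂ :=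
  ∫ x in Ω, ((κ : ℂ)⁻¹ * inner ℂ (weakGrad z.1 x) (w.snd x)
    - w.fst x * starRingEnd ℂ (z.1 x)
    - (κ : ℂ)⁻¹ * (w.fst x * starRingEnd ℂ (weakDiv z.2 x))
    - inner ℂ (z.2 x) (w.snd x))

/-- `B_κ' (η, v) = (-κ⁻¹ div v - η, κ⁻¹ ∇η - v)`. -/
noncomputable def adjointOp {Ω : Set (Eucl d)} (κ : ℝ) (z : L2 Ω × L2Vec Ω) : USpace Ω :=
  WithLp.toLp 2 (-((κ : ℂ)⁻¹ • weakDiv z.2) - z.1, (κ : ℂ)⁻¹ • weakGrad z.1 - z.2)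

/-- The optimal test norm `‖z‖_{V_∓,κ} = ‖B_κ' z‖_U`. -/
noncomputable def optimalTestNorm {Ω : Set (Eucl d)} (κ : ℝ) (z : L2 Ω × L2Vec Ω) : ℝ :=
  ‖adjointOp κ z‖

/-- The inf-sup constant
`γ = inf_{0 ≠ w ∈ Uδ} sup_{0 ≠ z ∈ Vδ} |(B_κ w) z| / (‖w‖_U ‖z‖_{V_∓,κ})`. -/
noncomputable def infSupConst {Ω : Set (Eucl d)} (κ : ℝ) (Uδ : Set (USpace Ω))
    (Vδ : Set (L2 Ω × L2Vec Ω)) : ℝ :=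
  ⨅ w : {w : USpace Ω // w ∈ Uδ ∧ w ≠ 0}, ⨆ z : {z : L2 Ω × L2Vec Ω // z ∈ Vδ ∧ z ≠ 0},
    ‖ultraWeakForm κ w.1 z.1‖ / (‖w.1‖ * optimalTestNorm κ z.1)

/-! ### Meshes and finite element spaces -/

/-- The closed simplex with vertex set `K`. -/
abbrev cell (K : Finset (Eucl d)) : Set (Eucl d) := convexHull ℝ (K : Set (Eucl d))

/-- `T` (a finite set of simplices, each given by its vertices) is a conforming subdivision of `Ω`
into `d`-simplices: the simplices are non-degenerate, they cover the closure of `Ω` exactly, and any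
two of them meet in the (possibly empty) face spanned by their common vertices. -/
structure IsConformingMesh (Ω : Set (Eucl d)) (T : Finset (Finset (Eucl d))) : Prop where
  card_eq : ∀ K ∈ T, K.card = d + 1
  indep : ∀ K ∈ T, AffineIndependent ℝ ((↑) : K → Eucl d)
  cover : ⋃ K ∈ T, cell K = closure Ω
  conforming : ∀ K ∈ T, ∀ K' ∈ T,
    cell K ∩ cell K' = convexHull ℝ ((K : Set (Eucl d)) ∩ (K' : Set (Eucl d)))

/-- Shape regularity with constant `ς`: each simplex `K` contains a ball of some diameter `ρ` with
`diam K ≤ ς ρ`. -/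
def IsShapeRegular (ς : ℝ) (T : Finset (Finset (Eucl d))) : Prop :=
  ∀ K ∈ T, ∃ (x : Eucl d) (ρ : ℝ), 0 < ρ ∧ Metric.closedBall x (ρ / 2) ⊆ cell K ∧
    Metric.diam (cell K) ≤ ς * ρ

/-- The minimal mesh size `min_{K ∈ T} |K|^(1/d)`. -/
noncomputable def hMin (T : Finset (Finset (Eucl d))) : ℝ :=
  ⨅ K : {K : Finset (Eucl d) // K ∈ T}, (volume.real (cell K.1)) ^ (1 / (d : ℝ))

/-- The value at a real point of a polynomial in `d` variables with complex coefficients. -/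
noncomputable def polyEval (q : MvPolynomial (Fin d) ℂ) (x : Eucl d) : ℂ :=
  MvPolynomial.eval (fun i => (x i : ℂ)) q

/-- On each simplex the function `v` is a polynomial of degree at most `p`. -/
def IsPiecewisePoly (Ω : Set (Eucl d)) (T : Finset (Finset (Eucl d))) (p : ℕ)
    (v : Eucl d → ℂ) : Prop :=
  ∀ K ∈ T, ∃ q : MvPolynomial (Fin d) ℂ, q.totalDegree ≤ p ∧
    ∀ᵐ x ∂(volume.restrict Ω), x ∈ cell K → v x = polyEval q x

/-- `S_p^{-1}(T)`: discontinuous piecewise polynomials of degree at most `p`. -/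
def discPoly (Ω : Set (Eucl d)) (T : Finset (Finset (Eucl d))) (p : ℕ) : Set (L2 Ω) :=
  {v | IsPiecewisePoly Ω T p v}

/-- `S_p^0(T)`: piecewise polynomials of degree at most `p` that are continuous on the closure of
`Ω`. -/
def contPoly (Ω : Set (Eucl d)) (T : Finset (Finset (Eucl d))) (p : ℕ) : Set (L2 Ω) :=
  {v | v ∈ discPoly Ω T p ∧
    ∃ f : Eucl d → ℂ, ContinuousOn f (closure Ω) ∧ v =ᵐ[volume.restrict Ω] f}

/-- The Raviart-Thomas space `RT_k(T)`: fields in `H(div; Ω)` whose restriction to each simplex lies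
in `P_k^d + x P̃_k`, where `P̃_k` are the homogeneous polynomials of degree `k`. In this indexing the
lowest order space is `RT_0`. -/
def raviartThomas (Ω : Set (Eucl d)) (T : Finset (Finset (Eucl d))) (k : ℕ) : Set (L2Vec Ω) :=
  {v | MemHdiv v ∧ ∀ K ∈ T, ∃ (q : Fin d → MvPolynomial (Fin d) ℂ) (r : MvPolynomial (Fin d) ℂ),
    (∀ i, (q i).totalDegree ≤ k) ∧ r.IsHomogeneous k ∧
      ∀ᵐ x ∂(volume.restrict Ω), x ∈ cell K →
        ∀ i, v x i = polyEval (q i) x + (x i : ℂ) * polyEval r x}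

/-- The trial space `Uδ = S_p^{-1}(T)^{d+1} ⊆ U`. -/
def trialSpace (Ω : Set (Eucl d)) (T : Finset (Finset (Eucl d))) (p : ℕ) : Set (USpace Ω) :=
  {w | w.fst ∈ discPoly Ω T p ∧ ∀ i : Fin d, IsPiecewisePoly Ω T p (fun x => w.snd x i)}

/-- The test space `Vδ_∓ = (S^0_{p+d+1}(T) × RT_{p+1}(T)) ∩ V_∓`. -/
def testSpace (Ω ΓD ΓR : Set (Eucl d)) (s : ℝ) (T : Finset (Finset (Eucl d))) (p : ℕ) :
    Set (L2 Ω × L2Vec Ω) :=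
  (contPoly Ω T (p + d + 1) ×ˢ raviartThomas Ω T (p + 1)) ∩ VSpace Ω ΓD ΓR s

end Helmholtz

open Helmholtz

/-!
The bound needs no Fortin operator: for every trial function `w = (φ, u)` there is an explicit test
function. With the barycentric coordinates `λ₀, …, λ_d` and the vertices `a₀, …, a_d` of an element
`K`, which contains a ball of diameter `ρ` comparable to its own diameter, put on `K`

  `η = (∏ₖ λₖ) φ`,   `v = ρ⁻² ∑ᵢⱼ λᵢ λⱼ (u · (aᵢ - aⱼ)) (aᵢ - aⱼ)`.

The function `η` vanishes on the boundary of every element. The `(i, j)` term of `v` vanishes on the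
faces opposite to `aᵢ` and `aⱼ` and is parallel to all the others, so `v` has zero normal trace on
every face. Hence `η ∈ H¹₀(Ω)` and `v ∈ H(div; Ω)`, their weak derivatives are the elementwise ones,
and all boundary conditions hold trivially. Moreover
`∑ᵢⱼ λᵢ λⱼ (cᵢ - cⱼ)(aᵢ - aⱼ) = 2 ∑ᵢ λᵢ cᵢ (aᵢ - x)`, which makes `v` a Raviart-Thomas field
(`bubbleField_apply`).

Since `v` is `u` multiplied by a positive semidefinite matrix, `⟨w, (η, v)⟩` is an integral of
`(∏ₖ λₖ) |φ|² + ρ⁻² ∑ᵢⱼ λᵢ λⱼ |u · (aᵢ - aⱼ)|²`. By equivalence of norms on polynomials and affine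
scaling (`exists_element_estimates`), and because the width of `K` in every direction is at least
`ρ` (`sq_mul_norm_sq_le_sum_cdot`), it is bounded below by a multiple of `‖w‖²`. In the same way
`‖(η, v)‖ ≲ ‖w‖`, and the inverse estimate gives `‖(-div v, ∇η)‖ ≲ h⁻¹ ‖w‖` for the minimal mesh
size `h` (`exists_test_pair`). In `B_κ' (η, v) = κ⁻¹ (-div v, ∇η) - (η, v)` the first term is
therefore a small perturbation of the second when `κ h` is large, and the Cauchy-Schwarz inequality
finishes the proof (`le_norm_inner_div`).

The absence of boundary terms is proved without traces: the test functions of an element are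
multiplied by smooth cutoffs supported inside it, which are admissible in the definition of weak
derivatives, and the cutoffs are removed by dominated convergence (`integral_mul_fderiv_bubble`).
-/

namespace Helmholtz

variable {d : ℕ}

/-! ### Polynomial functions -/

theorem contDiff_polyEval (q : MvPolynomial (Fin d) ℂ) {n : WithTop ℕ∞} :
    ContDiff ℝ n (polyEval q) := by
  have h : polyEval q = fun x : Eucl d =>
      ∑ m ∈ q.support, q.coeff m * ∏ i, (Complex.ofRealCLM (x i)) ^ m i := by
    funext x
    simp [polyEval, MvPolynomial.eval_eq']
  rw [h]
  fun_prop

theorem eq_zero_of_polyEval_eq_zero {q : MvPolynomial (Fin d) ℂ} {O : Set (Eucl d)} (hO : IsOpen O)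
    (hne : O.Nonempty) (h : ∀ x ∈ O, polyEval q x = 0) : q = 0 := by
  obtain ⟨x₀, hx₀⟩ := hne
  have hO' : IsOpen ((WithLp.toLp 2 : (Fin d → ℝ) → Eucl d) ⁻¹' O) :=
    hO.preimage (PiLp.continuous_toLp 2 _)
  obtain ⟨I, u, hu, hsub⟩ := isOpen_pi_iff.1 hO' x₀.ofLp (by simpa using hx₀)
  let s : Fin d → Set ℂ := fun i =>
    if i ∈ I then Complex.ofReal '' u i else Complex.ofReal '' Set.univ
  have hs : ∀ i, (s i).Infinite := by
    intro i
    by_cases hi : i ∈ I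
    · simp only [s, hi, if_true]
      exact (infinite_of_mem_nhds _ ((hu i hi).1.mem_nhds (hu i hi).2)).image
        Complex.ofReal_injective.injOn
    · simp only [s, hi, if_false]
      exact Set.infinite_univ.image Complex.ofReal_injective.injOn
  refine MvPolynomial.funext_set s hs ?_
  intro z hz
  have hz' : ∀ i, ∃ t : ℝ, (t : ℂ) = z i ∧ (i ∈ I → t ∈ u i) := by
    intro i
    have := hz i trivial
    by_cases hi : i ∈ I
    · simp only [s, hi, if_true] at this
      obtain ⟨t, ht, h⟩ := this
      exact ⟨t, h, fun _ => ht⟩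
    · simp only [s, hi, if_false] at this
      obtain ⟨t, ht, h⟩ := this
      exact ⟨t, h, fun h => absurd h hi⟩
  choose t ht htu using hz'
  have hmem : WithLp.toLp 2 t ∈ O := hsub (fun i hi => htu i hi)
  have := h _ hmem
  simp only [polyEval, ht] at this
  simpa using this

/-- The affine function `x ↦ ℓ x` as a polynomial of degree one. -/
noncomputable def affinePoly (ℓ : Eucl d →ᵃ[ℝ] ℝ) : MvPolynomial (Fin d) ℂ :=
  MvPolynomial.C (ℓ 0 : ℂ) +
    ∑ m, MvPolynomial.C (ℓ.linear (EuclideanSpace.single m 1) : ℂ) * MvPolynomial.X m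

theorem sum_smul_single (x : Eucl d) : ∑ m, x m • EuclideanSpace.single m (1 : ℝ) = x := by
  ext i
  simp [Pi.single_apply]

theorem affineMap_apply_eq (ℓ : Eucl d →ᵃ[ℝ] ℝ) (x : Eucl d) :
    ℓ x = ℓ 0 + ∑ m, ℓ.linear (EuclideanSpace.single m 1) * x m := by
  have h1 : ℓ x = ℓ.linear x + ℓ 0 := by
    have := congrFun ℓ.decomp x
    simpa using this
  have h2 : ℓ.linear x = ∑ m, ℓ.linear (EuclideanSpace.single m 1) * x m := by
    conv_lhs => rw [← sum_smul_single x]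
    simp [mul_comm]
  rw [h1, h2, add_comm]

theorem polyEval_affinePoly (ℓ : Eucl d →ᵃ[ℝ] ℝ) (x : Eucl d) :
    polyEval (affinePoly ℓ) x = (ℓ x : ℂ) := by
  rw [affineMap_apply_eq]
  simp [polyEval, affinePoly]

theorem totalDegree_affinePoly_le (ℓ : Eucl d →ᵃ[ℝ] ℝ) : (affinePoly ℓ).totalDegree ≤ 1 := by
  refine (MvPolynomial.totalDegree_add _ _).trans (max_le (by simp) ?_)
  refine MvPolynomial.totalDegree_finsetSum_le fun m _ => ?_
  refine (MvPolynomial.totalDegree_mul _ _).trans ?_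
  simp

theorem totalDegree_bind₁_le {σ τ R : Type*} [CommSemiring R]
    {f : σ → MvPolynomial τ R} (hf : ∀ i, (f i).totalDegree ≤ 1) (q : MvPolynomial σ R) :
    (MvPolynomial.bind₁ f q).totalDegree ≤ q.totalDegree := by
  rw [MvPolynomial.bind₁, MvPolynomial.aeval_def, MvPolynomial.eval₂_eq]
  refine MvPolynomial.totalDegree_finsetSum_le fun m hm => ?_
  refine (MvPolynomial.totalDegree_mul _ _).trans ?_
  have h1 : (algebraMap R (MvPolynomial τ R) (q.coeff m)).totalDegree = 0 := by
    rw [MvPolynomial.algebraMap_eq, MvPolynomial.totalDegree_C]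
  rw [h1, zero_add]
  refine (MvPolynomial.totalDegree_finsetProd _ _).trans ?_
  refine le_trans ?_ (MvPolynomial.le_totalDegree hm)
  rw [Finsupp.sum]
  refine Finset.sum_le_sum fun i _ => ?_
  refine (MvPolynomial.totalDegree_pow _ _).trans ?_
  simpa using Nat.mul_le_mul_left (m i) (hf i)

/-- Polynomials of bounded degree are stable under affine changes of variables. -/
theorem exists_polyEval_comp_affine (F : Eucl d →ᵃ[ℝ] Eucl d) (q : MvPolynomial (Fin d) ℂ) :
    ∃ q' : MvPolynomial (Fin d) ℂ, q'.totalDegree ≤ q.totalDegree ∧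
      ∀ x, polyEval q' x = polyEval q (F x) := by
  let c : Fin d → Eucl d →ᵃ[ℝ] ℝ := fun i =>
    (EuclideanSpace.proj i : Eucl d →L[ℝ] ℝ).toLinearMap.toAffineMap.comp F
  refine ⟨MvPolynomial.bind₁ (fun i => affinePoly (c i)) q,
    totalDegree_bind₁_le (fun i => totalDegree_affinePoly_le _) q, fun x => ?_⟩
  have h : ∀ i, MvPolynomial.eval (fun i => (x i : ℂ)) (affinePoly (c i)) = ((F x i : ℝ) : ℂ) :=
    fun i => polyEval_affinePoly (c i) x
  simp only [polyEval, MvPolynomial.eval, MvPolynomial.bind₁] at h ⊢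
  rw [← MvPolynomial.bind₁, MvPolynomial.eval₂Hom_bind₁]
  simp only [h]

/-! ### Simplices and barycentric coordinates -/

/-- The interior of the simplex spanned by an affine basis: the set where all barycentric
coordinates are positive. -/
def openSimplex (B : AffineBasis (Fin (d + 1)) ℝ (Eucl d)) : Set (Eucl d) :=
  {x | ∀ k, 0 < B.coord k x}

/-- The product `∏_{k ∈ S} λ_k` of barycentric coordinates. -/
noncomputable def bubble (B : AffineBasis (Fin (d + 1)) ℝ (Eucl d)) (S : Finset (Fin (d + 1)))
    (x : Eucl d) : ℝ :=
  ∏ k ∈ S, B.coord k x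

theorem contDiff_coord (B : AffineBasis (Fin (d + 1)) ℝ (Eucl d)) (k : Fin (d + 1))
    {n : WithTop ℕ∞} : ContDiff ℝ n (B.coord k) := by
  have h : (B.coord k : Eucl d → ℝ) =
      fun x => (LinearMap.toContinuousLinearMap (B.coord k).linear) x + B.coord k 0 := by
    funext x
    have := congrFun (B.coord k).decomp x
    simpa using this
  rw [h]
  fun_prop

theorem fderiv_coord (B : AffineBasis (Fin (d + 1)) ℝ (Eucl d)) (k : Fin (d + 1)) (x e : Eucl d) :
    fderiv ℝ (B.coord k) x e = (B.coord k).linear e := by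
  have h : (B.coord k : Eucl d → ℝ) =
      fun x => (LinearMap.toContinuousLinearMap (B.coord k).linear) x + B.coord k 0 := by
    funext x
    have := congrFun (B.coord k).decomp x
    simpa using this
  rw [h, fderiv_add_const, ContinuousLinearMap.fderiv]
  rfl

theorem contDiff_bubble (B : AffineBasis (Fin (d + 1)) ℝ (Eucl d)) (S : Finset (Fin (d + 1)))
    {n : WithTop ℕ∞} : ContDiff ℝ n (bubble B S) := by
  unfold bubble
  exact contDiff_prod fun k _ => contDiff_coord B k

theorem contDiff_bubble_smul (B : AffineBasis (Fin (d + 1)) ℝ (Eucl d)) (S : Finset (Fin (d + 1)))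
    {n : WithTop ℕ∞} {g : Eucl d → ℂ} (hg : ContDiff ℝ n g) :
    ContDiff ℝ n (fun x => (bubble B S x : ℂ) * g x) :=
  (Complex.ofRealCLM.contDiff.comp (contDiff_bubble B S)).mul hg

theorem isOpen_openSimplex (B : AffineBasis (Fin (d + 1)) ℝ (Eucl d)) :
    IsOpen (openSimplex B) := by
  simp only [openSimplex, Set.ofPred_forall]
  exact isOpen_iInter_of_finite fun k =>
    isOpen_lt continuous_const (contDiff_coord B k (n := 0)).continuous

theorem openSimplex_subset (B : AffineBasis (Fin (d + 1)) ℝ (Eucl d)) :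
    openSimplex B ⊆ convexHull ℝ (Set.range B) := by
  rw [B.convexHull_eq_nonneg_coord]
  exact fun x hx k => (hx k).le

theorem isCompact_simplex (B : AffineBasis (Fin (d + 1)) ℝ (Eucl d)) :
    IsCompact (convexHull ℝ (Set.range B)) :=
  (Set.finite_range B).isCompact_convexHull ℝ

theorem openSimplex_nonempty (B : AffineBasis (Fin (d + 1)) ℝ (Eucl d)) :
    (openSimplex B).Nonempty := by
  have h := B.centroid_mem_interior_convexHull
  rw [B.interior_convexHull] at h
  exact ⟨_, h⟩

theorem openSimplex_ae_eq (B : AffineBasis (Fin (d + 1)) ℝ (Eucl d)) :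
    openSimplex B =ᵐ[volume] (convexHull ℝ (Set.range B) : Set (Eucl d)) := by
  have h : openSimplex B = interior (convexHull ℝ (Set.range B)) := B.interior_convexHull.symm
  rw [h]
  exact interior_ae_eq_of_null_frontier ((convex_convexHull ℝ _).addHaar_frontier volume)

theorem integrableOn_openSimplex {E : Type*} [NormedAddCommGroup E]
    (B : AffineBasis (Fin (d + 1)) ℝ (Eucl d)) {f : Eucl d → E} (hf : Continuous f) :
    IntegrableOn f (openSimplex B) :=
  (hf.continuousOn.integrableOn_compact (isCompact_simplex B)).mono_set (openSimplex_subset B)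

theorem coord_le_one (B : AffineBasis (Fin (d + 1)) ℝ (Eucl d)) {x : Eucl d}
    (hx : x ∈ openSimplex B) (k : Fin (d + 1)) : B.coord k x ≤ 1 := by
  rw [← B.sum_coord_apply_eq_one x]
  exact Finset.single_le_sum (f := fun i => B.coord i x) (fun i _ => (hx i).le) (Finset.mem_univ k)

theorem bubble_pos (B : AffineBasis (Fin (d + 1)) ℝ (Eucl d)) {x : Eucl d}
    (hx : x ∈ openSimplex B) (S : Finset (Fin (d + 1))) : 0 < bubble B S x :=
  Finset.prod_pos fun k _ => hx k

theorem bubble_le_one (B : AffineBasis (Fin (d + 1)) ℝ (Eucl d)) {x : Eucl d}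
    (hx : x ∈ openSimplex B) (S : Finset (Fin (d + 1))) : bubble B S x ≤ 1 :=
  Finset.prod_le_one (fun k _ => (hx k).le) fun k _ => coord_le_one B hx k

theorem bubble_univ_le (B : AffineBasis (Fin (d + 1)) ℝ (Eucl d)) {x : Eucl d}
    (hx : x ∈ openSimplex B) (S : Finset (Fin (d + 1))) :
    bubble B Finset.univ x ≤ bubble B S x := by
  unfold bubble
  rw [← Finset.prod_sdiff (Finset.subset_univ S)]
  exact mul_le_of_le_one_left (bubble_pos B hx S).le (bubble_le_one B hx _)

/-! ### Inverse estimates by affine pullback -/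

theorem memLp_openSimplex {E : Type*} [NormedAddCommGroup E]
    (B : AffineBasis (Fin (d + 1)) ℝ (Eucl d)) {f : Eucl d → E} (hf : Continuous f) :
    MemLp f 2 (volume.restrict (openSimplex B)) := by
  refine (MemLp.mono_measure (Measure.restrict_mono_set volume (openSimplex_subset B))) ?_
  obtain ⟨M, hM⟩ := (isCompact_simplex B).exists_bound_of_continuousOn hf.continuousOn
  have : IsFiniteMeasure (volume.restrict (convexHull ℝ (Set.range B))) :=
    ⟨by simpa using (isCompact_simplex B).measure_lt_top⟩
  refine MemLp.of_bound (hf.continuousOn.aestronglyMeasurable_of_isCompact (isCompact_simplex B)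
    (isCompact_simplex B).measurableSet) M ?_
  exact (ae_restrict_mem (isCompact_simplex B).measurableSet).mono fun x hx => hM x hx

theorem norm_toLp_sq {α E : Type*} [MeasurableSpace α] {μ : Measure α} [NormedAddCommGroup E]
    [InnerProductSpace ℂ E] {f : α → E} (hf : MemLp f 2 μ) :
    ‖hf.toLp f‖ ^ 2 = ∫ x, ‖f x‖ ^ 2 ∂μ := by
  have h : ((‖hf.toLp f‖ ^ 2 : ℝ) : ℂ) = ((∫ x, ‖f x‖ ^ 2 ∂μ : ℝ) : ℂ) := by
    have h1 := inner_self_eq_norm_sq_to_K (𝕜 := ℂ) (hf.toLp f)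
    rw [L2.inner_def] at h1
    push_cast
    rw [← integral_complex_ofReal]
    refine h1.symm.trans (integral_congr_ae ?_)
    filter_upwards [hf.coeFn_toLp] with x hx
    rw [hx, inner_self_eq_norm_sq_to_K]
    push_cast
    rfl
  exact_mod_cast h

/-- On a finite-dimensional space, any two linear families of continuous functions are comparable
in `L₂` of a simplex as soon as the dominating one is injective there. -/
theorem exists_integral_norm_sq_le {V : Type*} [AddCommGroup V] [Module ℂ V]
    [FiniteDimensional ℂ V] (B : AffineBasis (Fin (d + 1)) ℝ (Eucl d))
    (S R : V →ₗ[ℂ] (Eucl d → ℂ)) (hS : ∀ v, Continuous (S v)) (hR : ∀ v, Continuous (R v))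
    (hinj : ∀ v, (∀ x ∈ openSimplex B, S v x = 0) → v = 0) :
    ∃ C : ℝ, 0 ≤ C ∧ ∀ v, ∫ x in openSimplex B, ‖R v x‖ ^ 2 ≤
      C * ∫ x in openSimplex B, ‖S v x‖ ^ 2 := by
  let toL : ∀ (A : V →ₗ[ℂ] (Eucl d → ℂ)), (∀ v, Continuous (A v)) →
      (V →ₗ[ℂ] Lp ℂ 2 (volume.restrict (openSimplex B))) := fun A hA =>
    { toFun := fun v => (memLp_openSimplex B (hA v)).toLp (A v)
      map_add' := fun v w => by
        rw [← MemLp.toLp_add]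
        exact MemLp.toLp_congr _ _ (ae_of_all _ fun x => by simp)
      map_smul' := fun c v => by
        simp only [RingHom.id_apply]
        rw [← MemLp.toLp_const_smul]
        exact MemLp.toLp_congr _ _ (ae_of_all _ fun x => by simp) }
  have hker : Function.Injective (toL S hS) := by
    rw [injective_iff_map_eq_zero]
    intro v hv
    apply hinj
    have h0 : S v =ᵐ[volume.restrict (openSimplex B)] 0 :=
      (MemLp.coeFn_toLp (memLp_openSimplex B (hS v))).symm.trans
        ((Lp.eq_zero_iff_ae_eq_zero).1 hv)
    have := Measure.eqOn_open_of_ae_eq h0 (isOpen_openSimplex B) (hS v).continuousOn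
      continuousOn_const
    exact fun x hx => this hx
  let T : LinearMap.range (toL S hS) →ₗ[ℂ] Lp ℂ 2 (volume.restrict (openSimplex B)) :=
    (toL R hR).comp (LinearEquiv.ofInjective (toL S hS) hker).symm.toLinearMap
  let T' := LinearMap.toContinuousLinearMap T
  refine ⟨‖T'‖ ^ 2, by positivity, fun v => ?_⟩
  rw [← norm_toLp_sq (memLp_openSimplex B (hS v)), ← norm_toLp_sq (memLp_openSimplex B (hR v)),
    ← mul_pow]
  have h1 : (memLp_openSimplex B (hR v)).toLp (R v) =
      T' (LinearEquiv.ofInjective (toL S hS) hker v) := by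
    change toL R hR v = toL R hR ((LinearEquiv.ofInjective (toL S hS) hker).symm _)
    rw [LinearEquiv.symm_apply_apply]
  have h2 := T'.le_opNorm (LinearEquiv.ofInjective (toL S hS) hker v)
  rw [← h1] at h2
  exact pow_le_pow_left₀ (norm_nonneg _) h2 2

/-- `q ↦ polyEval q`, on polynomials of degree at most `p`. -/
noncomputable def polyEvalLM (d p : ℕ) :
    MvPolynomial.restrictTotalDegree (Fin d) ℂ p →ₗ[ℂ] (Eucl d → ℂ) where
  toFun q := polyEval q.1
  map_add' q r := by funext x; simp [polyEval]
  map_smul' c q := by funext x; simp [polyEval]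

/-- Multiplication by the square root of the bubble, on the simplex. -/
noncomputable def sqrtBubbleLM (p : ℕ) (B : AffineBasis (Fin (d + 1)) ℝ (Eucl d)) :
    MvPolynomial.restrictTotalDegree (Fin d) ℂ p →ₗ[ℂ] (Eucl d → ℂ) where
  toFun q := fun x => (Real.sqrt (bubble B Finset.univ x) : ℂ) * polyEval q.1 x
  map_add' q r := by funext x; simp [polyEval, mul_add]
  map_smul' c q := by funext x; simp [polyEval, mul_left_comm]

/-- The directional derivative along `e` of the product of a polynomial and a bubble. -/
noncomputable def derivBubbleLM (p : ℕ) (B : AffineBasis (Fin (d + 1)) ℝ (Eucl d))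
    (S : Finset (Fin (d + 1))) (e : Eucl d) :
    MvPolynomial.restrictTotalDegree (Fin d) ℂ p →ₗ[ℂ] (Eucl d → ℂ) where
  toFun q := fun x => fderiv ℝ (fun y => (bubble B S y : ℂ) * polyEval q.1 y) x e
  map_add' q r := by
    funext x
    have hd : ∀ q : MvPolynomial (Fin d) ℂ,
        DifferentiableAt ℝ (fun y => (bubble B S y : ℂ) * polyEval q y) x := fun q =>
      ((contDiff_bubble_smul B S (contDiff_polyEval q (n := 1))).differentiable
        one_ne_zero).differentiableAt
    have h : (fun y => (bubble B S y : ℂ) * polyEval (q + r).1 y) =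
        (fun y => (bubble B S y : ℂ) * polyEval q.1 y) +
          fun y => (bubble B S y : ℂ) * polyEval r.1 y := by
      funext y; simp [polyEval, mul_add]
    rw [h, fderiv_add (hd _) (hd _)]
    simp
  map_smul' c q := by
    funext x
    have hd : ∀ q : MvPolynomial (Fin d) ℂ,
        DifferentiableAt ℝ (fun y => (bubble B S y : ℂ) * polyEval q y) x := fun q =>
      ((contDiff_bubble_smul B S (contDiff_polyEval q (n := 1))).differentiable
        one_ne_zero).differentiableAt
    have h : (fun y => (bubble B S y : ℂ) * polyEval (c • q).1 y) =
        c • fun y => (bubble B S y : ℂ) * polyEval q.1 y := by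
      funext y; simp [polyEval, mul_left_comm]
    rw [h, fderiv_const_smul (hd _)]
    simp

theorem continuous_fderiv_apply {f : Eucl d → ℂ} (hf : ContDiff ℝ 1 f) (e : Eucl d) :
    Continuous fun x => fderiv ℝ f x e :=
  (hf.continuous_fderiv one_ne_zero).clm_apply continuous_const

theorem exists_reference_bubble_le (p : ℕ) (B : AffineBasis (Fin (d + 1)) ℝ (Eucl d)) :
    ∃ C : ℝ, 0 ≤ C ∧ ∀ q : MvPolynomial (Fin d) ℂ, q.totalDegree ≤ p →
      ∫ x in openSimplex B, ‖polyEval q x‖ ^ 2 ≤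
        C * ∫ x in openSimplex B, bubble B Finset.univ x * ‖polyEval q x‖ ^ 2 := by
  obtain ⟨C, hC, h⟩ := exists_integral_norm_sq_le B (sqrtBubbleLM p B) (polyEvalLM d p)
    (fun q => (Complex.continuous_ofReal.comp (Real.continuous_sqrt.comp
      (contDiff_bubble B _ (n := 0)).continuous)).mul (contDiff_polyEval q.1 (n := 0)).continuous)
    (fun q => (contDiff_polyEval q.1 (n := 0)).continuous)
    (fun q hq => by
      apply Subtype.ext
      refine eq_zero_of_polyEval_eq_zero (isOpen_openSimplex B) (openSimplex_nonempty B)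
        fun x hx => ?_
      have h1 := hq x hx
      have h2 : (Real.sqrt (bubble B Finset.univ x) : ℂ) ≠ 0 := by
        exact_mod_cast (Real.sqrt_pos.2 (bubble_pos B hx _)).ne'
      exact (mul_eq_zero.1 h1).resolve_left h2)
  refine ⟨C, hC, fun q hq => ?_⟩
  have h1 := h ⟨q, (MvPolynomial.mem_restrictTotalDegree _ _ _).2 hq⟩
  refine h1.trans (le_of_eq ?_)
  congr 1
  refine setIntegral_congr_fun (isOpen_openSimplex B).measurableSet fun x hx => ?_
  simp only [sqrtBubbleLM, LinearMap.coe_mk, AddHom.coe_mk]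
  rw [norm_mul, mul_pow, Complex.norm_real, Real.norm_eq_abs, sq_abs,
    Real.sq_sqrt (bubble_pos B hx _).le]

theorem exists_reference_deriv_le (p : ℕ) (B : AffineBasis (Fin (d + 1)) ℝ (Eucl d))
    (S : Finset (Fin (d + 1))) (e : Eucl d) :
    ∃ C : ℝ, 0 ≤ C ∧ ∀ q : MvPolynomial (Fin d) ℂ, q.totalDegree ≤ p →
      ∫ x in openSimplex B, ‖fderiv ℝ (fun y => (bubble B S y : ℂ) * polyEval q y) x e‖ ^ 2 ≤
        C * ∫ x in openSimplex B, ‖polyEval q x‖ ^ 2 := by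
  obtain ⟨C, hC, h⟩ := exists_integral_norm_sq_le B (polyEvalLM d p) (derivBubbleLM p B S e)
    (fun q => (contDiff_polyEval q.1 (n := 0)).continuous)
    (fun q => continuous_fderiv_apply (contDiff_bubble_smul B S (contDiff_polyEval q.1)) e)
    (fun q hq => Subtype.ext (eq_zero_of_polyEval_eq_zero (isOpen_openSimplex B)
      (openSimplex_nonempty B) hq))
  exact ⟨C, hC, fun q hq => h ⟨q, (MvPolynomial.mem_restrictTotalDegree _ _ _).2 hq⟩⟩

/-- Any two simplices are related by an affine isomorphism which respects barycentric coordinates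
and scales integrals by a constant factor. -/
theorem exists_affine_pullback (B₀ B : AffineBasis (Fin (d + 1)) ℝ (Eucl d)) :
    ∃ (F : Eucl d →ᵃ[ℝ] Eucl d) (δ : ℝ), 0 < δ ∧ (∀ k x, B.coord k (F x) = B₀.coord k x) ∧
      (∀ i j, F.linear (B₀ i - B₀ j) = B i - B j) ∧
      ∀ f : Eucl d → ℝ, ∫ x in openSimplex B, f x = δ * ∫ x in openSimplex B₀, f (F x) := by
  let L : Eucl d ≃ₗ[ℝ] Eucl d := (B₀.basisOf 0).equiv (B.basisOf 0) (Equiv.refl _)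
  let L' : Eucl d →L[ℝ] Eucl d := LinearMap.toContinuousLinearMap L.toLinearMap
  have hL : ∀ i, L (B₀ i - B₀ 0) = B i - B 0 := by
    intro i
    by_cases hi : i = 0
    · simp [hi]
    · have := Module.Basis.equiv_apply (B₀.basisOf 0) ⟨i, hi⟩ (B.basisOf 0) (Equiv.refl _)
      simpa using this
  let F : Eucl d →ᵃ[ℝ] Eucl d :=
    L.toLinearMap.toAffineMap + AffineMap.const ℝ (Eucl d) (B 0 - L (B₀ 0))
  have hFx : ∀ x, F x = L x + (B 0 - L (B₀ 0)) := fun x => rfl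
  have hFlin : F.linear = L.toLinearMap := by simp [F]
  have hFB : ∀ i, F (B₀ i) = B i := by
    intro i
    have := hL i
    rw [map_sub] at this
    rw [hFx, add_sub, add_sub_right_comm, this]
    simp
  have hcoord : ∀ k x, B.coord k (F x) = B₀.coord k x := by
    intro k x
    have : (B.coord k).comp F = B₀.coord k := by
      refine AffineMap.ext_on B₀.tot ?_
      rintro _ ⟨i, rfl⟩
      simp [hFB, AffineBasis.coord_apply]
    exact congrArg (fun f : Eucl d →ᵃ[ℝ] ℝ => f x) this
  have hdet : L'.det ≠ 0 := by
    change LinearMap.det (L : Eucl d →ₗ[ℝ] Eucl d) ≠ 0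
    exact (LinearEquiv.isUnit_det' L).ne_zero
  have hFd : ∀ x, HasFDerivAt F L' x := fun x => (L'.hasFDerivAt).add_const _
  have hFinj : Function.Injective F := fun x y h => by
    rw [hFx, hFx] at h
    exact L.injective (add_right_cancel h)
  have hsurj : Function.Surjective F := fun y => by
    refine ⟨L.symm (y - (B 0 - L (B₀ 0))), ?_⟩
    rw [hFx, LinearEquiv.apply_symm_apply, sub_add_cancel]
  have himg : F '' openSimplex B₀ = openSimplex B := by
    ext y
    constructor
    · rintro ⟨x, hx, rfl⟩ k
      rw [hcoord]
      exact hx k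
    · intro hy
      obtain ⟨x, rfl⟩ := hsurj y
      exact ⟨x, fun k => by rw [← hcoord]; exact hy k, rfl⟩
  refine ⟨F, |L'.det|, abs_pos.2 hdet, hcoord, ?_, ?_⟩
  · intro i j
    rw [hFlin]
    have : L (B₀ i - B₀ j) = (B i - B 0) - (B j - B 0) := by
      rw [← hL i, ← hL j, ← map_sub L, sub_sub_sub_cancel_right]
    rw [LinearEquiv.coe_coe, this, sub_sub_sub_cancel_right]
  · intro f
    rw [← himg, integral_image_eq_integral_abs_det_fderiv_smul volume
      (isOpen_openSimplex B₀).measurableSet (fun x _ => (hFd x).hasFDerivWithinAt) hFinj.injOn]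
    simp only [smul_eq_mul]
    rw [integral_const_mul]

/-- The scaling argument: weighting by the bubble costs a bounded factor on polynomials, and along
edges of the simplex polynomials times bubbles satisfy an inverse estimate. The constant depends
only on the dimension and the degree, not on the simplex. -/
theorem exists_element_estimates (d p : ℕ) :
    ∃ C : ℝ, 0 < C ∧ ∀ (B : AffineBasis (Fin (d + 1)) ℝ (Eucl d)) (q : MvPolynomial (Fin d) ℂ),
      q.totalDegree ≤ p →
      (∫ x in openSimplex B, ‖polyEval q x‖ ^ 2 ≤
        C * ∫ x in openSimplex B, bubble B Finset.univ x * ‖polyEval q x‖ ^ 2) ∧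
      ∀ S i j, ∫ x in openSimplex B,
          ‖fderiv ℝ (fun y => (bubble B S y : ℂ) * polyEval q y) x (B i - B j)‖ ^ 2 ≤
        C * ∫ x in openSimplex B, ‖polyEval q x‖ ^ 2 := by
  obtain ⟨B₀⟩ : Nonempty (AffineBasis (Fin (d + 1)) ℝ (Eucl d)) :=
    AffineBasis.exists_affineBasis_of_finiteDimensional (by simp)
  obtain ⟨C₁, hC₁, h₁⟩ := exists_reference_bubble_le p B₀
  choose C₂ hC₂ h₂ using fun (z : Finset (Fin (d + 1)) × Fin (d + 1) × Fin (d + 1)) =>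
    exists_reference_deriv_le p B₀ z.1 (B₀ z.2.1 - B₀ z.2.2)
  have hsum : ∀ z, C₂ z ≤ ∑ z, C₂ z := fun z =>
    Finset.single_le_sum (f := C₂) (fun z _ => hC₂ z) (Finset.mem_univ z)
  have hs0 : 0 ≤ ∑ z, C₂ z := Finset.sum_nonneg fun z _ => hC₂ z
  refine ⟨C₁ + ∑ z, C₂ z + 1, by positivity, fun B q hq => ?_⟩
  obtain ⟨F, δ, hδ, hco, hlin, hint⟩ := exists_affine_pullback B₀ B
  obtain ⟨q', hq', hqq⟩ := exists_polyEval_comp_affine F q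
  have hbub : ∀ S x, bubble B S (F x) = bubble B₀ S x := fun S x => by
    simp only [bubble, hco]
  have hI : 0 ≤ ∫ x in openSimplex B₀, ‖polyEval q' x‖ ^ 2 :=
    integral_nonneg fun x => by positivity
  have hI' : 0 ≤ ∫ x in openSimplex B₀, bubble B₀ Finset.univ x * ‖polyEval q' x‖ ^ 2 :=
    setIntegral_nonneg (isOpen_openSimplex B₀).measurableSet fun x hx =>
      mul_nonneg (bubble_pos B₀ hx _).le (by positivity)
  constructor
  · rw [hint, hint]
    simp only [hbub, ← hqq]
    have := h₁ q' (hq'.trans hq)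
    calc _ ≤ δ * (C₁ * ∫ x in openSimplex B₀, bubble B₀ Finset.univ x * ‖polyEval q' x‖ ^ 2) := by
          gcongr
      _ ≤ δ * ((C₁ + ∑ z, C₂ z + 1) *
          ∫ x in openSimplex B₀, bubble B₀ Finset.univ x * ‖polyEval q' x‖ ^ 2) := by
          gcongr
          linarith
      _ = _ := by ring
  · intro S i j
    rw [hint, hint]
    have hder : ∀ x, fderiv ℝ (fun y => (bubble B S y : ℂ) * polyEval q y) (F x) (B i - B j) =
        fderiv ℝ (fun y => (bubble B₀ S y : ℂ) * polyEval q' y) x (B₀ i - B₀ j) := by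
      intro x
      have hF : HasFDerivAt F (LinearMap.toContinuousLinearMap F.linear) x := by
        have h : (F : Eucl d → Eucl d) =
            fun x => (LinearMap.toContinuousLinearMap F.linear) x + F 0 := by
          funext x
          have := congrFun F.decomp x
          simpa using this
        rw [h]
        exact (ContinuousLinearMap.hasFDerivAt _).add_const _
      have h1 : (fun y => (bubble B₀ S y : ℂ) * polyEval q' y) =
          (fun y => (bubble B S y : ℂ) * polyEval q y) ∘ F := by
        funext y
        simp [hbub, hqq]
      have h2 : DifferentiableAt ℝ (fun y => (bubble B S y : ℂ) * polyEval q y) (F x) :=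
        ((contDiff_bubble_smul B S (contDiff_polyEval q (n := 1))).differentiable
          one_ne_zero).differentiableAt
      rw [h1, (h2.hasFDerivAt.comp x hF).fderiv, ContinuousLinearMap.comp_apply]
      simp [hlin]
    simp only [hder, ← hqq]
    have := h₂ (S, i, j) q' (hq'.trans hq)
    calc _ ≤ δ * (C₂ (S, i, j) * ∫ x in openSimplex B₀, ‖polyEval q' x‖ ^ 2) := by
          gcongr
      _ ≤ δ * ((C₁ + ∑ z, C₂ z + 1) * ∫ x in openSimplex B₀, ‖polyEval q' x‖ ^ 2) := by
          gcongr
          linarith [hsum (S, i, j)]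
      _ = _ := by ring

/-! ### Integration by parts on a simplex against weak derivatives -/

/-- A smooth step: `0` for `t ≤ 1 / n` and `1` for `t ≥ 2 / n`. -/
noncomputable def step (n : ℕ) (t : ℝ) : ℝ := Real.smoothTransition (n * t - 1)

theorem contDiff_step (n : ℕ) {m : ℕ∞} : ContDiff ℝ m (step n) := by
  unfold step
  exact Real.smoothTransition.contDiff.comp (by fun_prop)

theorem step_nonneg (n : ℕ) (t : ℝ) : 0 ≤ step n t := Real.smoothTransition.nonneg _

theorem step_le_one (n : ℕ) (t : ℝ) : step n t ≤ 1 := Real.smoothTransition.le_one _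

theorem eventually_two_lt_mul {t : ℝ} (ht : 0 < t) : ∀ᶠ n : ℕ in atTop, 2 < (n : ℝ) * t :=
  (tendsto_natCast_atTop_atTop.atTop_mul_const ht).eventually_gt_atTop 2

theorem tendsto_step {t : ℝ} (ht : 0 < t) : Tendsto (fun n => step n t) atTop (𝓝 1) := by
  refine tendsto_const_nhds.congr' ?_
  filter_upwards [eventually_two_lt_mul ht] with n hn
  exact (Real.smoothTransition.one_of_one_le (by linarith)).symm

theorem deriv_step (n : ℕ) (t : ℝ) :
    deriv (step n) t = n * deriv Real.smoothTransition (n * t - 1) := by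
  have h1 : HasDerivAt Real.smoothTransition (deriv Real.smoothTransition (n * t - 1))
      (n * t - 1) :=
    ((Real.smoothTransition.contDiff (n := 1)).differentiable
      one_ne_zero).differentiableAt.hasDerivAt
  have h2 : HasDerivAt (fun t : ℝ => (n : ℝ) * t - 1) n t := by
    simpa using ((hasDerivAt_id t).const_mul (n : ℝ)).sub_const 1
  rw [mul_comm]
  exact (h1.comp t h2).deriv

theorem deriv_smoothTransition_of_neg {t : ℝ} (ht : t < 0) :
    deriv Real.smoothTransition t = 0 := by
  have h : Real.smoothTransition =ᶠ[𝓝 t] fun _ => 0 := by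
    filter_upwards [gt_mem_nhds ht] with s hs
    exact Real.smoothTransition.zero_of_nonpos hs.le
  rw [h.deriv_eq, deriv_const]

theorem deriv_smoothTransition_of_one_lt {t : ℝ} (ht : 1 < t) :
    deriv Real.smoothTransition t = 0 := by
  have h : Real.smoothTransition =ᶠ[𝓝 t] fun _ => 1 := by
    filter_upwards [lt_mem_nhds ht] with s hs
    exact Real.smoothTransition.one_of_one_le hs.le
  rw [h.deriv_eq, deriv_const]

theorem tendsto_mul_deriv_step {t : ℝ} (ht : 0 < t) :
    Tendsto (fun n => t * deriv (step n) t) atTop (𝓝 0) := by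
  refine tendsto_const_nhds.congr' ?_
  filter_upwards [eventually_two_lt_mul ht] with n hn
  rw [deriv_step, deriv_smoothTransition_of_one_lt (by linarith)]
  simp

/-- The steps get steeper, but only at distance comparable to their width from `0`. -/
theorem exists_mul_deriv_step_le : ∃ M : ℝ, 0 ≤ M ∧ ∀ n t, |t * deriv (step n) t| ≤ M := by
  have hc : Continuous fun s : ℝ => s * deriv Real.smoothTransition (s - 1) :=
    continuous_id.mul (((Real.smoothTransition.contDiff (n := 1)).continuous_deriv le_rfl).comp
      (continuous_id.sub continuous_const))
  have hs : HasCompactSupport fun s : ℝ => s * deriv Real.smoothTransition (s - 1) := by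
    refine HasCompactSupport.intro (isCompact_Icc (a := (1 : ℝ)) (b := 2)) fun s hs => ?_
    rw [Set.mem_Icc, not_and_or, not_le, not_le] at hs
    rcases hs with hs | hs
    · rw [deriv_smoothTransition_of_neg (by linarith), mul_zero]
    · rw [deriv_smoothTransition_of_one_lt (by linarith), mul_zero]
  obtain ⟨M, hM⟩ := hs.exists_bound_of_continuous hc
  refine ⟨M, (norm_nonneg _).trans (hM 0), fun n t => ?_⟩
  have := hM (n * t)
  rw [deriv_step, show t * (n * deriv Real.smoothTransition (n * t - 1)) =
    n * t * deriv Real.smoothTransition (n * t - 1) by ring]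
  exact this

/-- A smooth cutoff function of the simplex, equal to `1` away from the boundary. -/
noncomputable def cutoff (B : AffineBasis (Fin (d + 1)) ℝ (Eucl d)) (n : ℕ) (x : Eucl d) : ℝ :=
  ∏ k, step n (B.coord k x)

theorem contDiff_cutoff (B : AffineBasis (Fin (d + 1)) ℝ (Eucl d)) (n : ℕ) {m : ℕ∞} :
    ContDiff ℝ m (cutoff B n) := by
  unfold cutoff
  exact contDiff_prod fun k _ => (contDiff_step n).comp (contDiff_coord B k)

theorem cutoff_mem_Icc (B : AffineBasis (Fin (d + 1)) ℝ (Eucl d)) (n : ℕ) (x : Eucl d) :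
    cutoff B n x ∈ Set.Icc 0 1 :=
  ⟨Finset.prod_nonneg fun _ _ => step_nonneg _ _,
    Finset.prod_le_one (fun _ _ => step_nonneg _ _) fun _ _ => step_le_one _ _⟩

theorem tendsto_cutoff (B : AffineBasis (Fin (d + 1)) ℝ (Eucl d)) {x : Eucl d}
    (hx : x ∈ openSimplex B) : Tendsto (fun n => cutoff B n x) atTop (𝓝 1) := by
  have := tendsto_finsetProd (Finset.univ : Finset (Fin (d + 1)))
    (fun k _ => tendsto_step (hx k))
  simpa [cutoff] using this

theorem isTestFunction_cutoff_mul (B : AffineBasis (Fin (d + 1)) ℝ (Eucl d)) {n : ℕ} (hn : n ≠ 0)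
    {h : Eucl d → ℝ} (hh : ContDiff ℝ ∞ h) :
    IsTestFunction (openSimplex B) fun x => cutoff B n x * h x := by
  have hn' : (0 : ℝ) < n := by exact_mod_cast Nat.pos_of_ne_zero hn
  let A : Set (Eucl d) := {x | ∀ k, 1 / (n : ℝ) ≤ B.coord k x}
  have hA : IsClosed A := by
    simp only [A, Set.ofPred_forall]
    exact isClosed_iInter fun k =>
      isClosed_le continuous_const (contDiff_coord B k (n := 0)).continuous
  have hAO : A ⊆ openSimplex B := fun x hx k => (one_div_pos.2 hn').trans_le (hx k)
  have hAc : IsCompact A :=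
    (isCompact_simplex B).of_isClosed_subset hA (hAO.trans (openSimplex_subset B))
  have hsupp : Function.support (fun x => cutoff B n x * h x) ⊆ A := by
    intro x hx k
    by_contra hk
    rw [not_le, lt_div_iff₀ hn'] at hk
    apply hx
    have h0 : step n (B.coord k x) = 0 := Real.smoothTransition.zero_of_nonpos (by nlinarith)
    have h1 : cutoff B n x = 0 := Finset.prod_eq_zero (Finset.mem_univ k) h0
    simp [h1]
  have ht : tsupport (fun x => cutoff B n x * h x) ⊆ A := closure_minimal hsupp hA
  exact ⟨(contDiff_cutoff B n).mul hh, hAc.of_isClosed_subset (isClosed_tsupport _) ht,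
    ht.trans hAO⟩

theorem fderiv_cutoff (B : AffineBasis (Fin (d + 1)) ℝ (Eucl d)) (n : ℕ) (x e : Eucl d) :
    fderiv ℝ (cutoff B n) x e = ∑ k, (∏ l ∈ Finset.univ.erase k, step n (B.coord l x)) *
      (deriv (step n) (B.coord k x) * (B.coord k).linear e) := by
  have h : ∀ k ∈ (Finset.univ : Finset (Fin (d + 1))),
      HasFDerivAt (fun x => step n (B.coord k x))
        (deriv (step n) (B.coord k x) • fderiv ℝ (B.coord k) x) x := by
    intro k _
    have h1 : HasDerivAt (step n) (deriv (step n) (B.coord k x)) (B.coord k x) :=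
      ((contDiff_step n (m := 1)).differentiable one_ne_zero).differentiableAt.hasDerivAt
    exact h1.comp_hasFDerivAt x
      ((contDiff_coord B k (n := 1)).differentiable one_ne_zero).differentiableAt.hasFDerivAt
  have := (HasFDerivAt.finsetProd h).fderiv
  have h2 : cutoff B n = fun x => ∏ k, step n (B.coord k x) := rfl
  rw [h2, this]
  simp [fderiv_coord]

/-- Multiplied by a function that vanishes on the faces crossed by the direction `e`, the derivative
of the cutoff along `e` stays bounded and tends to zero. -/
theorem bubble_mul_fderiv_cutoff (B : AffineBasis (Fin (d + 1)) ℝ (Eucl d))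
    (S : Finset (Fin (d + 1))) (e : Eucl d) (he : ∀ k ∉ S, (B.coord k).linear e = 0) :
    (∃ M : ℝ, 0 ≤ M ∧ ∀ n, ∀ x ∈ openSimplex B, |bubble B S x * fderiv ℝ (cutoff B n) x e| ≤ M) ∧
    ∀ x ∈ openSimplex B,
      Tendsto (fun n => bubble B S x * fderiv ℝ (cutoff B n) x e) atTop (𝓝 0) := by
  have key : ∀ n x, bubble B S x * fderiv ℝ (cutoff B n) x e =
      ∑ k ∈ S, (bubble B (S.erase k) x * (∏ l ∈ Finset.univ.erase k, step n (B.coord l x)) *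
        (B.coord k).linear e) * (B.coord k x * deriv (step n) (B.coord k x)) := by
    intro n x
    rw [fderiv_cutoff, ← Finset.sum_subset (Finset.subset_univ S), Finset.mul_sum]
    · refine Finset.sum_congr rfl fun k hk => ?_
      have : bubble B S x = B.coord k x * bubble B (S.erase k) x :=
        (Finset.mul_prod_erase S (fun k => B.coord k x) hk).symm
      rw [this]
      ring
    · intro k _ hk
      rw [he k hk]
      ring
  have hprod : ∀ n x (s : Finset (Fin (d + 1))), |∏ l ∈ s, step n (B.coord l x)| ≤ 1 := by
    intro n x s
    rw [abs_of_nonneg (Finset.prod_nonneg fun _ _ => step_nonneg _ _)]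
    exact Finset.prod_le_one (fun _ _ => step_nonneg _ _) fun _ _ => step_le_one _ _
  have hfac : ∀ n, ∀ x ∈ openSimplex B, ∀ k,
      |bubble B (S.erase k) x * (∏ l ∈ Finset.univ.erase k, step n (B.coord l x)) *
        (B.coord k).linear e| ≤ |(B.coord k).linear e| := by
    intro n x hx k
    rw [abs_mul, abs_mul, abs_of_pos (bubble_pos B hx _)]
    refine mul_le_of_le_one_left (abs_nonneg _) ?_
    exact mul_le_one₀ (bubble_le_one B hx _) (abs_nonneg _) (hprod _ _ _)
  obtain ⟨M, hM0, hM⟩ := exists_mul_deriv_step_le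
  constructor
  · refine ⟨∑ k ∈ S, |(B.coord k).linear e| * M, by positivity, fun n x hx => ?_⟩
    rw [key]
    refine (Finset.abs_sum_le_sum_abs _ _).trans (Finset.sum_le_sum fun k _ => ?_)
    rw [abs_mul]
    exact mul_le_mul (hfac n x hx k) (hM n _) (abs_nonneg _) (abs_nonneg _)
  · intro x hx
    simp only [key]
    rw [show (0 : ℝ) = ∑ k ∈ S, 0 by simp]
    refine tendsto_finsetSum _ fun k _ => ?_
    have hz : Tendsto (fun n => |(B.coord k).linear e| *
        |B.coord k x * deriv (step n) (B.coord k x)|) atTop (𝓝 0) := by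
      have := ((tendsto_mul_deriv_step (hx k)).abs).const_mul |(B.coord k).linear e|
      rwa [abs_zero, mul_zero] at this
    refine squeeze_zero_norm' (Eventually.of_forall fun n => ?_) hz
    rw [norm_mul, Real.norm_eq_abs, Real.norm_eq_abs]
    exact mul_le_mul_of_nonneg_right (hfac n x hx k) (abs_nonneg _)

/-- `G` is the weak derivative of `ψ` in the direction `e` on the open set `O`. -/
def HasWeakDirDeriv (O : Set (Eucl d)) (e : Eucl d) (ψ G : Eucl d → ℂ) : Prop :=
  ∀ ξ : Eucl d → ℝ, IsTestFunction O ξ →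
    ∫ x in O, ψ x * (fderiv ℝ ξ x e : ℂ) = -∫ x in O, G x * (ξ x : ℂ)

theorem integral_mul_fderiv_bubble_real (B : AffineBasis (Fin (d + 1)) ℝ (Eucl d))
    (S : Finset (Fin (d + 1))) {e : Eucl d} (he : ∀ k ∉ S, (B.coord k).linear e = 0)
    {ψ G : Eucl d → ℂ} (hψ : IntegrableOn ψ (openSimplex B)) (hG : IntegrableOn G (openSimplex B))
    (hw : HasWeakDirDeriv (openSimplex B) e ψ G) {g : Eucl d → ℝ} (hg : ContDiff ℝ ∞ g) :
    ∫ x in openSimplex B, ψ x * (fderiv ℝ (fun y => bubble B S y * g y) x e : ℂ) =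
      -∫ x in openSimplex B, G x * ((bubble B S x * g x : ℝ) : ℂ) := by
  have hO := (isOpen_openSimplex B).measurableSet
  set h : Eucl d → ℝ := fun y => bubble B S y * g y with hh
  have hhs : ContDiff ℝ ∞ h := (contDiff_bubble B S).mul hg
  have hder : ∀ n x, fderiv ℝ (fun x => cutoff B n x * h x) x e =
      cutoff B n x * fderiv ℝ h x e + g x * (bubble B S x * fderiv ℝ (cutoff B n) x e) := by
    intro n x
    have h1 : DifferentiableAt ℝ (cutoff B n) x :=
      ((contDiff_cutoff B n (m := 1)).differentiable one_ne_zero).differentiableAt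
    have h2 : DifferentiableAt ℝ h x := (hhs.differentiable (by simp)).differentiableAt
    rw [fderiv_fun_mul h1 h2]
    simp only [add_apply, smul_apply, smul_eq_mul, hh]
    ring
  obtain ⟨⟨M, hM0, hM⟩, hlim⟩ := bubble_mul_fderiv_cutoff B S e he
  obtain ⟨Mg, hMg⟩ := (isCompact_simplex B).exists_bound_of_continuousOn hg.continuous.continuousOn
  obtain ⟨Mh, hMh⟩ :=
    (isCompact_simplex B).exists_bound_of_continuousOn hhs.continuous.continuousOn
  have hdc : Continuous fun x => fderiv ℝ h x e :=
    (hhs.continuous_fderiv (by simp)).clm_apply continuous_const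
  obtain ⟨Md, hMd⟩ := (isCompact_simplex B).exists_bound_of_continuousOn hdc.continuousOn
  have hcut : ∀ n, Continuous (cutoff B n) := fun n => (contDiff_cutoff B n (m := 0)).continuous
  have hξ : ∀ n, Continuous fun x => fderiv ℝ (fun x => cutoff B n x * h x) x e := fun n =>
    ((((contDiff_cutoff B n).mul hhs).continuous_fderiv (n := ∞) (by simp)).clm_apply
      continuous_const)
  have hlhs : Tendsto (fun n => ∫ x in openSimplex B,
      ψ x * (fderiv ℝ (fun x => cutoff B n x * h x) x e : ℂ)) atTop
      (𝓝 (∫ x in openSimplex B, ψ x * (fderiv ℝ h x e : ℂ))) := by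
    refine tendsto_integral_of_dominated_convergence (fun x => ‖ψ x‖ * (Md + Mg * M))
      (fun n => ?_) (hψ.norm.mul_const _) (fun n => ?_) ?_
    · exact hψ.aestronglyMeasurable.mul
        (Complex.continuous_ofReal.comp (hξ n)).aestronglyMeasurable
    · refine (ae_restrict_mem hO).mono fun x hx => ?_
      have hx' := openSimplex_subset B hx
      rw [norm_mul, Complex.norm_real, hder]
      refine mul_le_mul_of_nonneg_left ((norm_add_le _ _).trans (add_le_add ?_ ?_)) (norm_nonneg _)
      · rw [norm_mul, Real.norm_eq_abs, abs_of_nonneg (cutoff_mem_Icc B n x).1]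
        exact (mul_le_of_le_one_left (norm_nonneg _) (cutoff_mem_Icc B n x).2).trans (hMd x hx')
      · rw [norm_mul]
        exact mul_le_mul (hMg x hx') (hM n x hx) (norm_nonneg _)
          ((norm_nonneg _).trans (hMg x hx'))
    · refine (ae_restrict_mem hO).mono fun x hx => ?_
      have h1 : Tendsto (fun n => fderiv ℝ (fun x => cutoff B n x * h x) x e) atTop
          (𝓝 (fderiv ℝ h x e)) := by
        simp only [hder]
        simpa using ((tendsto_cutoff B hx).mul_const (fderiv ℝ h x e)).add
          ((hlim x hx).const_mul (g x))
      exact ((Complex.continuous_ofReal.tendsto _).comp h1).const_mul _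
  have hrhs : Tendsto (fun n => -∫ x in openSimplex B, G x * ((cutoff B n x * h x : ℝ) : ℂ)) atTop
      (𝓝 (-∫ x in openSimplex B, G x * ((h x : ℝ) : ℂ))) := by
    refine Tendsto.neg ?_
    refine tendsto_integral_of_dominated_convergence (fun x => ‖G x‖ * Mh)
      (fun n => ?_) (hG.norm.mul_const _) (fun n => ?_) ?_
    · exact hG.aestronglyMeasurable.mul
        (Complex.continuous_ofReal.comp ((hcut n).mul hhs.continuous)).aestronglyMeasurable
    · refine (ae_restrict_mem hO).mono fun x hx => ?_
      rw [norm_mul, Complex.norm_real, norm_mul, Real.norm_eq_abs (cutoff B n x),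
        abs_of_nonneg (cutoff_mem_Icc B n x).1]
      refine mul_le_mul_of_nonneg_left ?_ (norm_nonneg _)
      exact (mul_le_of_le_one_left (norm_nonneg _) (cutoff_mem_Icc B n x).2).trans
        (hMh x (openSimplex_subset B hx))
    · refine (ae_restrict_mem hO).mono fun x hx => ?_
      have h1 : Tendsto (fun n => cutoff B n x * h x) atTop (𝓝 (h x)) := by
        simpa using (tendsto_cutoff B hx).mul_const (h x)
      exact ((Complex.continuous_ofReal.tendsto _).comp h1).const_mul _
  refine tendsto_nhds_unique hlhs (hrhs.congr' ?_)
  filter_upwards [eventually_ne_atTop 0] with n hn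
  exact (hw _ (isTestFunction_cutoff_mul B hn hhs)).symm

/-- Integration by parts on a simplex against a weak derivative along `e`, without boundary terms:
the factor `∏_{k ∈ S} λ_k` vanishes on every face which the direction `e` crosses. -/
theorem integral_mul_fderiv_bubble (B : AffineBasis (Fin (d + 1)) ℝ (Eucl d))
    (S : Finset (Fin (d + 1))) {e : Eucl d} (he : ∀ k ∉ S, (B.coord k).linear e = 0)
    {ψ G : Eucl d → ℂ} (hψ : IntegrableOn ψ (openSimplex B)) (hG : IntegrableOn G (openSimplex B))
    (hw : HasWeakDirDeriv (openSimplex B) e ψ G) {g : Eucl d → ℂ} (hg : ContDiff ℝ ∞ g) :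
    ∫ x in openSimplex B, ψ x * fderiv ℝ (fun y => (bubble B S y : ℂ) * g y) x e =
      -∫ x in openSimplex B, G x * ((bubble B S x : ℂ) * g x) := by
  have hre : ContDiff ℝ ∞ fun x => (g x).re := Complex.reCLM.contDiff.comp hg
  have him : ContDiff ℝ ∞ fun x => (g x).im := Complex.imCLM.contDiff.comp hg
  have h1 := integral_mul_fderiv_bubble_real B S he hψ hG hw hre
  have h2 := integral_mul_fderiv_bubble_real B S he hψ hG hw him
  have hmul : ∀ {a : Eucl d → ℂ} {b : Eucl d → ℝ}, IntegrableOn a (openSimplex B) →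
      Continuous b → IntegrableOn (fun x => a x * (b x : ℂ)) (openSimplex B) := by
    intro a b ha hb
    obtain ⟨M, hM⟩ := (isCompact_simplex B).exists_bound_of_continuousOn hb.continuousOn
    refine Integrable.mul_bdd ha (c := M) (Complex.continuous_ofReal.comp hb).aestronglyMeasurable ?_
    refine (ae_restrict_mem (isOpen_openSimplex B).measurableSet).mono fun x hx => ?_
    rw [Complex.norm_real]
    exact hM x (openSimplex_subset B hx)
  have hd : ∀ {b : Eucl d → ℝ}, ContDiff ℝ ∞ b →
      Continuous fun x => fderiv ℝ (fun y => bubble B S y * b y) x e := fun hb =>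
    (((contDiff_bubble B S).mul hb).continuous_fderiv (n := ∞) (by simp)).clm_apply
      continuous_const
  have hc : ∀ {b : Eucl d → ℝ}, ContDiff ℝ ∞ b → Continuous fun x => bubble B S x * b x :=
    fun hb => ((contDiff_bubble B S (n := ∞)).mul hb).continuous
  have hder : ∀ x, fderiv ℝ (fun y => (bubble B S y : ℂ) * g y) x e =
      (fderiv ℝ (fun y => bubble B S y * (g y).re) x e : ℂ) +
        (fderiv ℝ (fun y => bubble B S y * (g y).im) x e : ℂ) * Complex.I := by
    intro x
    have hda : ∀ {b : Eucl d → ℝ}, ContDiff ℝ ∞ b →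
        HasFDerivAt (fun y => ((bubble B S y * b y : ℝ) : ℂ))
          (Complex.ofRealCLM.comp (fderiv ℝ (fun y => bubble B S y * b y) x)) x := fun hb =>
      (Complex.ofRealCLM.hasFDerivAt).comp x
        ((((contDiff_bubble B S (n := ∞)).mul hb).differentiable
          (by simp)).differentiableAt.hasFDerivAt)
    have h3 := (hda hre).add ((hda him).mul_const Complex.I)
    have h4 : (fun y => (bubble B S y : ℂ) * g y) =
        (fun y => ((bubble B S y * (g y).re : ℝ) : ℂ)) +
          fun y => ((bubble B S y * (g y).im : ℝ) : ℂ) * Complex.I := by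
      funext y
      conv_lhs => rw [← Complex.re_add_im (g y)]
      simp only [Pi.add_apply]
      push_cast
      ring
    rw [h4, h3.fderiv]
    simp [mul_comm]
  have hL : ∀ x, ψ x * fderiv ℝ (fun y => (bubble B S y : ℂ) * g y) x e =
      ψ x * (fderiv ℝ (fun y => bubble B S y * (g y).re) x e : ℂ) +
        (ψ x * (fderiv ℝ (fun y => bubble B S y * (g y).im) x e : ℂ)) * Complex.I := fun x => by
    rw [hder]; ring
  have hR : ∀ x, G x * ((bubble B S x : ℂ) * g x) =
      G x * ((bubble B S x * (g x).re : ℝ) : ℂ) +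
        (G x * ((bubble B S x * (g x).im : ℝ) : ℂ)) * Complex.I := fun x => by
    conv_lhs => rw [← Complex.re_add_im (g x)]
    push_cast
    ring
  simp only [hL, hR]
  rw [integral_add (hmul hψ (hd hre)) ((hmul hψ (hd him)).mul_const _),
    integral_add (hmul hG (hc hre)) ((hmul hG (hc him)).mul_const _),
    integral_mul_const, integral_mul_const, h1, h2]
  ring

/-! ### The element test functions -/

/-- The bilinear product `u · e` of a complex with a real vector. -/
noncomputable def cdot (u : CVec d) (e : Eucl d) : ℂ := ∑ m, u m * (e m : ℂ)

/-- A real vector as a complex one. -/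
noncomputable def cvec (e : Eucl d) : CVec d := WithLp.toLp 2 fun m => (e m : ℂ)

/-- The gradient of a complex-valued function. -/
noncomputable def gradC (f : Eucl d → ℂ) (x : Eucl d) : CVec d :=
  WithLp.toLp 2 fun m => fderiv ℝ f x (EuclideanSpace.single m 1)

@[simp] theorem cvec_apply (e : Eucl d) (m : Fin d) : cvec e m = (e m : ℂ) := rfl

@[simp] theorem gradC_apply (f : Eucl d → ℂ) (x : Eucl d) (m : Fin d) :
    gradC f x m = fderiv ℝ f x (EuclideanSpace.single m 1) := rfl

theorem cdot_eq_inner (u : CVec d) (e : Eucl d) : cdot u e = inner ℂ (cvec e) u := by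
  simp [cdot, PiLp.inner_apply]

theorem norm_cvec (e : Eucl d) : ‖cvec e‖ = ‖e‖ := by
  simp [EuclideanSpace.norm_eq]

theorem norm_cdot_le (u : CVec d) (e : Eucl d) : ‖cdot u e‖ ≤ ‖u‖ * ‖e‖ := by
  rw [cdot_eq_inner, mul_comm, ← norm_cvec]
  exact norm_inner_le_norm _ _

theorem continuous_cdot (e : Eucl d) : Continuous fun u : CVec d => cdot u e := by
  unfold cdot
  fun_prop

theorem clm_apply_eq_sum {E : Type*} [NormedAddCommGroup E] [NormedSpace ℝ E]
    (A : Eucl d →L[ℝ] E) (e : Eucl d) : A e = ∑ m, e m • A (EuclideanSpace.single m 1) := by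
  conv_lhs => rw [← sum_smul_single e]
  simp

theorem cdot_gradC (f : Eucl d → ℂ) (x e : Eucl d) : cdot (gradC f x) e = fderiv ℝ f x e := by
  rw [clm_apply_eq_sum (fderiv ℝ f x) e]
  simp [cdot, mul_comm]

/-- The `H(div)` part of the element test function: `u` multiplied by the positive semidefinite
matrix `∑ᵢⱼ λᵢ λⱼ (aᵢ - aⱼ)(aᵢ - aⱼ)ᵀ`. The coefficient `bubble B {i, j}` is `λᵢ λⱼ` unless
`i = j`, where the edge vector vanishes. -/
noncomputable def bubbleField (B : AffineBasis (Fin (d + 1)) ℝ (Eucl d)) (u : Eucl d → CVec d)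
    (x : Eucl d) : CVec d :=
  ∑ i, ∑ j, ((bubble B {i, j} x : ℂ) * cdot (u x) (B i - B j)) • cvec (B i - B j)

/-- The divergence of `bubbleField B u`. -/
noncomputable def bubbleFieldDiv (B : AffineBasis (Fin (d + 1)) ℝ (Eucl d)) (u : Eucl d → CVec d)
    (x : Eucl d) : ℂ :=
  ∑ i, ∑ j, fderiv ℝ (fun y => (bubble B {i, j} y : ℂ) * cdot (u y) (B i - B j)) x (B i - B j)

theorem contDiff_cdot {u : Eucl d → CVec d} {n : WithTop ℕ∞} (hu : ∀ m, ContDiff ℝ n fun x => u x m)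
    (e : Eucl d) : ContDiff ℝ n fun x => cdot (u x) e := by
  unfold cdot
  exact ContDiff.sum fun m _ => (hu m).mul contDiff_const

theorem continuous_bubbleField (B : AffineBasis (Fin (d + 1)) ℝ (Eucl d)) {u : Eucl d → CVec d}
    (hu : ∀ m, ContDiff ℝ ∞ fun x => u x m) : Continuous (bubbleField B u) := by
  unfold bubbleField
  exact continuous_finsetSum _ fun i _ => continuous_finsetSum _ fun j _ =>
    (contDiff_bubble_smul B _ (contDiff_cdot hu _)).continuous.smul continuous_const

theorem continuous_bubbleFieldDiv (B : AffineBasis (Fin (d + 1)) ℝ (Eucl d)) {u : Eucl d → CVec d}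
    (hu : ∀ m, ContDiff ℝ ∞ fun x => u x m) : Continuous (bubbleFieldDiv B u) := by
  unfold bubbleFieldDiv
  exact continuous_finsetSum _ fun i _ => continuous_finsetSum _ fun j _ =>
    continuous_fderiv_apply ((contDiff_bubble_smul B _ (contDiff_cdot hu _)).of_le (by simp)) _

theorem continuous_gradC {f : Eucl d → ℂ} (hf : ContDiff ℝ ∞ f) : Continuous (gradC f) := by
  unfold gradC
  exact (PiLp.continuous_toLp 2 _).comp
    (continuous_pi fun m => continuous_fderiv_apply (hf.of_le (by simp)) _)

/-- The edges `aᵢ aⱼ` are parallel to all faces but those opposite to `aᵢ` and `aⱼ`. -/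
theorem coord_linear_edge (B : AffineBasis (Fin (d + 1)) ℝ (Eucl d)) {i j k : Fin (d + 1)}
    (hk : k ∉ ({i, j} : Finset (Fin (d + 1)))) : (B.coord k).linear (B i - B j) = 0 := by
  simp only [Finset.mem_insert, Finset.mem_singleton, not_or] at hk
  have := (B.coord k).linearMap_vsub (B i) (B j)
  rw [vsub_eq_sub] at this
  rw [this, B.coord_apply_ne hk.1, B.coord_apply_ne hk.2, vsub_self]

/-- Green's formula on an element, without boundary term: `bubbleField B u` has zero normal trace.
-/
theorem integral_bubbleField (B : AffineBasis (Fin (d + 1)) ℝ (Eucl d)) {u : Eucl d → CVec d}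
    (hu : ∀ m, ContDiff ℝ ∞ fun x => u x m) {ψ : Eucl d → ℂ} {G : Eucl d → CVec d}
    (hψ : IntegrableOn ψ (openSimplex B)) (hG : IntegrableOn G (openSimplex B))
    (hw : ∀ e, HasWeakDirDeriv (openSimplex B) e ψ fun x => cdot (G x) e) :
    ∫ x in openSimplex B, ∑ m, bubbleField B u x m * G x m =
      -∫ x in openSimplex B, bubbleFieldDiv B u x * ψ x := by
  have hGe : ∀ e, IntegrableOn (fun x => cdot (G x) e) (openSimplex B) := by
    intro e
    refine Integrable.mono' (hG.norm.mul_const ‖e‖)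
      ((continuous_cdot e).comp_aestronglyMeasurable hG.aestronglyMeasurable)
      (ae_of_all _ fun x => norm_cdot_le _ _)
  have hbd : ∀ {a b : Eucl d → ℂ}, IntegrableOn a (openSimplex B) → Continuous b →
      IntegrableOn (fun x => a x * b x) (openSimplex B) := by
    intro a b ha hb
    obtain ⟨M, hM⟩ := (isCompact_simplex B).exists_bound_of_continuousOn hb.continuousOn
    refine Integrable.mul_bdd ha (c := M) hb.aestronglyMeasurable ?_
    exact (ae_restrict_mem (isOpen_openSimplex B).measurableSet).mono fun x hx =>
      hM x (openSimplex_subset B hx)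
  have hsm : ∀ i j, ContDiff ℝ ∞ fun x =>
      (bubble B {i, j} x : ℂ) * cdot (u x) (B i - B j) := fun i j =>
    contDiff_bubble_smul B _ (contDiff_cdot hu _)
  have h1 : ∀ x, ∑ m, bubbleField B u x m * G x m = ∑ i, ∑ j,
      cdot (G x) (B i - B j) * ((bubble B {i, j} x : ℂ) * cdot (u x) (B i - B j)) := by
    intro x
    simp only [bubbleField, WithLp.ofLp_sum, Finset.sum_apply, Finset.sum_mul]
    rw [Finset.sum_comm]
    refine Finset.sum_congr rfl fun i _ => ?_
    rw [Finset.sum_comm]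
    refine Finset.sum_congr rfl fun j _ => ?_
    generalize cdot (u x) (B i - B j) = c
    rw [cdot, Finset.sum_mul]
    refine Finset.sum_congr rfl fun m _ => ?_
    simp only [PiLp.smul_apply, cvec_apply, smul_eq_mul]
    ring
  have h2 : ∀ x, bubbleFieldDiv B u x * ψ x = ∑ i, ∑ j, ψ x *
      fderiv ℝ (fun y => (bubble B {i, j} y : ℂ) * cdot (u y) (B i - B j)) x (B i - B j) := by
    intro x
    simp only [bubbleFieldDiv, Finset.sum_mul, mul_comm (ψ x)]
  simp only [h1, h2]
  rw [integral_finsetSum _ fun i _ => integrable_finsetSum _ fun j _ =>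
      hbd (hGe _) (hsm i j).continuous,
    integral_finsetSum _ fun i _ => integrable_finsetSum _ fun j _ =>
      hbd hψ (continuous_fderiv_apply ((hsm i j).of_le (by simp)) _), ← Finset.sum_neg_distrib]
  refine Finset.sum_congr rfl fun i _ => ?_
  rw [integral_finsetSum _ fun j _ => hbd (hGe _) (hsm i j).continuous,
    integral_finsetSum _ fun j _ =>
      hbd hψ (continuous_fderiv_apply ((hsm i j).of_le (by simp)) _), ← Finset.sum_neg_distrib]
  refine Finset.sum_congr rfl fun j _ => ?_
  rw [integral_mul_fderiv_bubble B {i, j} (fun k hk => coord_linear_edge B hk) hψ (hGe _) (hw _)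
    (contDiff_cdot hu _), neg_neg]

theorem fderiv_eq_zero_of_notMem_tsupport {χ : Eucl d → ℝ} {x : Eucl d} (hx : x ∉ tsupport χ)
    (e : Eucl d) : fderiv ℝ χ x e = 0 := by
  have h : χ =ᶠ[𝓝 x] fun _ => 0 := notMem_tsupport_iff_eventuallyEq.1 hx
  rw [h.fderiv_eq]
  simp

theorem setIntegral_mul_fderiv_test {O : Set (Eucl d)} {ξ : Eucl d → ℝ} (hξ : IsTestFunction O ξ)
    (f : Eucl d → ℂ) (e : Eucl d) :
    ∫ x in O, f x * (fderiv ℝ ξ x e : ℂ) = ∫ x, f x * (fderiv ℝ ξ x e : ℂ) :=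
  setIntegral_eq_integral_of_forall_compl_eq_zero fun x hx => by
    rw [fderiv_eq_zero_of_notMem_tsupport fun h => hx (hξ.2.2 h)]
    simp

theorem setIntegral_mul_test {O : Set (Eucl d)} {ξ : Eucl d → ℝ} (hξ : IsTestFunction O ξ)
    (f : Eucl d → ℂ) : ∫ x in O, f x * (ξ x : ℂ) = ∫ x, f x * (ξ x : ℂ) :=
  setIntegral_eq_integral_of_forall_compl_eq_zero fun x hx => by
    rw [image_eq_zero_of_notMem_tsupport fun h => hx (hξ.2.2 h)]
    simp

/-- A classical derivative is a weak derivative. -/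
theorem hasWeakDirDeriv_of_contDiff (O : Set (Eucl d)) (e : Eucl d) {χ : Eucl d → ℝ}
    (hχ : ContDiff ℝ ∞ χ) :
    HasWeakDirDeriv O e (fun x => (χ x : ℂ)) fun x => (fderiv ℝ χ x e : ℂ) := by
  intro ξ hξ
  rw [setIntegral_mul_fderiv_test hξ, setIntegral_mul_test hξ]
  have hd : Continuous fun x => fderiv ℝ χ x e :=
    (hχ.continuous_fderiv (by simp)).clm_apply continuous_const
  have hd' : Continuous fun x => fderiv ℝ ξ x e :=
    (hξ.1.continuous_fderiv (by simp)).clm_apply continuous_const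
  have h := integral_mul_fderiv_eq_neg_fderiv_mul_of_integrable (μ := volume) (f := χ) (g := ξ)
    (v := e)
    ((hd.mul hξ.1.continuous).integrable_of_hasCompactSupport hξ.2.1.mul_left)
    ((hχ.continuous.mul hd').integrable_of_hasCompactSupport
      ((hξ.2.1.fderiv_apply ℝ e).mul_left))
    ((hχ.continuous.mul hξ.1.continuous).integrable_of_hasCompactSupport hξ.2.1.mul_left)
    (fun x _ => hχ.differentiable (by simp) x) fun x _ => hξ.1.differentiable (by simp) x
  simp only [← Complex.ofReal_mul]
  rw [integral_complex_ofReal, integral_complex_ofReal, h]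
  push_cast
  rfl

/-! ### Stability of the element test functions -/

/-- The width of a simplex in any direction is at least the diameter of an inscribed ball, and is
attained by a pair of vertices. -/
theorem sq_mul_norm_sq_le_sum_inner (B : AffineBasis (Fin (d + 1)) ℝ (Eucl d)) {x₀ : Eucl d} {ρ : ℝ}
    (hρ : 0 < ρ) (hball : Metric.closedBall x₀ (ρ / 2) ⊆ convexHull ℝ (Set.range B)) (e : Eucl d) :
    ρ ^ 2 * ‖e‖ ^ 2 ≤ ∑ i, ∑ j, (inner ℝ e (B i - B j)) ^ 2 := by
  rcases eq_or_ne e 0 with rfl | he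
  · simp
  have hen : 0 < ‖e‖ := norm_pos_iff.2 he
  let t : Eucl d := (ρ / 2 / ‖e‖) • e
  have ht : ‖t‖ = ρ / 2 := by
    simp only [t, norm_smul, Real.norm_eq_abs]
    rw [abs_of_pos (by positivity)]
    field_simp
  have hp : x₀ + t ∈ convexHull ℝ (Set.range B) := hball (by simp [ht])
  have hm : x₀ - t ∈ convexHull ℝ (Set.range B) := hball (by simp [ht])
  have hconv : ConvexOn ℝ Set.univ fun y : Eucl d => (inner ℝ e y : ℝ) :=
    ((innerSL ℝ e).toLinearMap).convexOn convex_univ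
  have hconc : ConcaveOn ℝ Set.univ fun y : Eucl d => (inner ℝ e y : ℝ) :=
    ((innerSL ℝ e).toLinearMap).concaveOn convex_univ
  obtain ⟨_, ⟨i, rfl⟩, hi⟩ := hconv.exists_ge_of_mem_convexHull (Set.subset_univ _) hp
  obtain ⟨_, ⟨j, rfl⟩, hj⟩ := hconc.exists_le_of_mem_convexHull (Set.subset_univ _) hm
  have hin : inner ℝ e t = ρ / 2 * ‖e‖ := by
    simp only [t, inner_smul_right, real_inner_self_eq_norm_sq]
    field_simp
  rw [inner_add_right, hin] at hi
  rw [inner_sub_right, hin] at hj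
  have hij : ρ * ‖e‖ ≤ inner ℝ e (B i - B j) := by
    rw [inner_sub_right]
    linarith
  calc ρ ^ 2 * ‖e‖ ^ 2 = (ρ * ‖e‖) ^ 2 := by ring
    _ ≤ (inner ℝ e (B i - B j)) ^ 2 := pow_le_pow_left₀ (by positivity) hij 2
    _ ≤ ∑ j, (inner ℝ e (B i - B j)) ^ 2 :=
        Finset.single_le_sum (f := fun j => (inner ℝ e (B i - B j)) ^ 2)
          (fun j _ => sq_nonneg _) (Finset.mem_univ j)
    _ ≤ _ := Finset.single_le_sum (f := fun i => ∑ j, (inner ℝ e (B i - B j)) ^ 2)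
          (fun i _ => Finset.sum_nonneg fun j _ => sq_nonneg _) (Finset.mem_univ i)

theorem sq_mul_norm_sq_le_sum_cdot (B : AffineBasis (Fin (d + 1)) ℝ (Eucl d)) {x₀ : Eucl d} {ρ : ℝ}
    (hρ : 0 < ρ) (hball : Metric.closedBall x₀ (ρ / 2) ⊆ convexHull ℝ (Set.range B)) (u : CVec d) :
    ρ ^ 2 * ‖u‖ ^ 2 ≤ ∑ i, ∑ j, ‖cdot u (B i - B j)‖ ^ 2 := by
  let a : Eucl d := WithLp.toLp 2 fun m => (u m).re
  let b : Eucl d := WithLp.toLp 2 fun m => (u m).im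
  have hn : ‖u‖ ^ 2 = ‖a‖ ^ 2 + ‖b‖ ^ 2 := by
    rw [EuclideanSpace.norm_sq_eq, EuclideanSpace.norm_sq_eq, EuclideanSpace.norm_sq_eq,
      ← Finset.sum_add_distrib]
    refine Finset.sum_congr rfl fun m _ => ?_
    rw [← Complex.normSq_eq_norm_sq, Complex.normSq_apply]
    simp [a, b]
    ring
  have hc : ∀ e, ‖cdot u e‖ ^ 2 = (inner ℝ a e) ^ 2 + (inner ℝ b e) ^ 2 := by
    intro e
    have h1 : (cdot u e).re = inner ℝ a e := by
      simp [cdot, a, PiLp.inner_apply, mul_comm]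
    have h2 : (cdot u e).im = inner ℝ b e := by
      simp [cdot, b, PiLp.inner_apply, mul_comm]
    rw [← Complex.normSq_eq_norm_sq, Complex.normSq_apply, h1, h2]
    ring
  simp only [hc, Finset.sum_add_distrib]
  rw [hn, mul_add]
  exact add_le_add (sq_mul_norm_sq_le_sum_inner B hρ hball a)
    (sq_mul_norm_sq_le_sum_inner B hρ hball b)

theorem norm_edge_le (B : AffineBasis (Fin (d + 1)) ℝ (Eucl d)) (i j : Fin (d + 1)) :
    ‖B i - B j‖ ≤ Metric.diam (convexHull ℝ (Set.range B)) := by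
  rw [← dist_eq_norm]
  exact Metric.dist_le_diam_of_mem (isCompact_simplex B).isBounded
    (subset_convexHull ℝ _ ⟨i, rfl⟩) (subset_convexHull ℝ _ ⟨j, rfl⟩)

theorem inner_bubbleField (B : AffineBasis (Fin (d + 1)) ℝ (Eucl d)) (u : Eucl d → CVec d)
    (x : Eucl d) : inner ℂ (bubbleField B u x) (u x) =
      ((∑ i, ∑ j, bubble B {i, j} x * ‖cdot (u x) (B i - B j)‖ ^ 2 : ℝ) : ℂ) := by
  simp only [bubbleField, sum_inner, inner_smul_left, ← cdot_eq_inner]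
  push_cast
  refine Finset.sum_congr rfl fun i _ => Finset.sum_congr rfl fun j _ => ?_
  rw [map_mul, Complex.conj_ofReal, mul_assoc, Complex.conj_mul']

theorem norm_bubbleField_le (B : AffineBasis (Fin (d + 1)) ℝ (Eucl d)) (u : Eucl d → CVec d)
    {D : ℝ} (hD : ∀ i j, ‖B i - B j‖ ≤ D) {x : Eucl d} (hx : x ∈ openSimplex B) :
    ‖bubbleField B u x‖ ≤ (d + 1) ^ 2 * D ^ 2 * ‖u x‖ := by
  have h : ∀ i j : Fin (d + 1),
      ‖((bubble B {i, j} x : ℂ) * cdot (u x) (B i - B j)) • cvec (B i - B j)‖ ≤ D ^ 2 * ‖u x‖ := by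
    intro i j
    have hD0 : 0 ≤ D := (norm_nonneg _).trans (hD i j)
    rw [norm_smul, norm_mul, norm_cvec, Complex.norm_real, Real.norm_eq_abs,
      abs_of_pos (bubble_pos B hx _)]
    calc _ ≤ 1 * (‖u x‖ * D) * D := by
          gcongr
          · exact bubble_le_one B hx _
          · exact (norm_cdot_le _ _).trans (mul_le_mul_of_nonneg_left (hD i j) (norm_nonneg _))
          · exact hD i j
      _ = _ := by ring
  refine (norm_sum_le_of_le _ fun i _ => norm_sum_le_of_le _ fun j _ => h i j).trans ?_
  simp
  apply le_of_eq
  ring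

theorem exists_polyEval_eq_cdot {p : ℕ} {q : Fin d → MvPolynomial (Fin d) ℂ}
    (hq : ∀ m, (q m).totalDegree ≤ p) (e : Eucl d) :
    ∃ s : MvPolynomial (Fin d) ℂ, s.totalDegree ≤ p ∧
      ∀ x, polyEval s x = cdot (WithLp.toLp 2 fun m => polyEval (q m) x) e := by
  refine ⟨∑ m, q m * MvPolynomial.C (e m : ℂ), ?_, fun x => by simp [polyEval, cdot]⟩
  refine MvPolynomial.totalDegree_finsetSum_le fun m _ => ?_
  exact (MvPolynomial.totalDegree_mul _ _).trans (by simpa using hq m)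

theorem norm_sum_sum_sq_le {n : ℕ} (a : Fin n → Fin n → ℂ) :
    ‖∑ i, ∑ j, a i j‖ ^ 2 ≤ n ^ 2 * ∑ i, ∑ j, ‖a i j‖ ^ 2 := by
  have h1 : ‖∑ i, ∑ j, a i j‖ ≤ ∑ z : Fin n × Fin n, ‖a z.1 z.2‖ := by
    rw [← Fintype.sum_prod_type' (f := a)]
    exact norm_sum_le _ _
  have h2 := sq_sum_le_card_mul_sum_sq (s := (Finset.univ : Finset (Fin n × Fin n)))
    (f := fun z => ‖a z.1 z.2‖)
  rw [Fintype.sum_prod_type (f := fun z : Fin n × Fin n => ‖a z.1 z.2‖ ^ 2)] at h2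
  refine (pow_le_pow_left₀ (norm_nonneg _) h1 2).trans (h2.trans (le_of_eq ?_))
  rw [Finset.card_univ, Fintype.card_prod, Fintype.card_fin]
  push_cast
  ring

/-- The stability estimates for the element test functions, with a constant that depends only on the
dimension and the degree. The geometry of the element enters through the diameter `ρ` of an
inscribed ball and the bound `D` on the edge lengths. -/
theorem exists_local_stability (d p : ℕ) :
    ∃ C : ℝ, 0 < C ∧ ∀ (B : AffineBasis (Fin (d + 1)) ℝ (Eucl d)) (x₀ : Eucl d) (ρ D : ℝ), 0 < ρ →
      Metric.closedBall x₀ (ρ / 2) ⊆ convexHull ℝ (Set.range B) → (∀ i j, ‖B i - B j‖ ≤ D) →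
      ∀ (q : MvPolynomial (Fin d) ℂ) (r : Fin d → MvPolynomial (Fin d) ℂ), q.totalDegree ≤ p →
      (∀ m, (r m).totalDegree ≤ p) →
      ∀ u : Eucl d → CVec d, (u = fun x => WithLp.toLp 2 fun m => polyEval (r m) x) →
      (∫ x in openSimplex B, ‖polyEval q x‖ ^ 2 ≤
        C * ∫ x in openSimplex B, bubble B Finset.univ x * ‖polyEval q x‖ ^ 2) ∧
      (ρ ^ 2 * ∫ x in openSimplex B, ‖u x‖ ^ 2 ≤
        C * ∫ x in openSimplex B, ∑ i, ∑ j, bubble B {i, j} x * ‖cdot (u x) (B i - B j)‖ ^ 2) ∧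
      (ρ ^ 2 * ∫ x in openSimplex B,
          ‖gradC (fun y => (bubble B Finset.univ y : ℂ) * polyEval q y) x‖ ^ 2 ≤
        C * ∫ x in openSimplex B, ‖polyEval q x‖ ^ 2) ∧
      ∫ x in openSimplex B, ‖bubbleFieldDiv B u x‖ ^ 2 ≤
        C * D ^ 2 * ∫ x in openSimplex B, ‖u x‖ ^ 2 := by
  obtain ⟨C, hC, hel⟩ := exists_element_estimates d p
  refine ⟨C * (d + 1) ^ 4, by positivity, ?_⟩
  intro B x₀ ρ D hρ hball hD q r hq hr u hu
  have hO := (isOpen_openSimplex B).measurableSet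
  have hN : (1 : ℝ) ≤ (d + 1 : ℝ) ^ 4 := one_le_pow₀ (by linarith [Nat.cast_nonneg (α := ℝ) d])
  have hN2 : (d + 1 : ℝ) ^ 2 ≤ (d + 1 : ℝ) ^ 4 :=
    pow_le_pow_right₀ (by linarith [Nat.cast_nonneg (α := ℝ) d]) (by norm_num)
  choose s hs hsu using fun e => exists_polyEval_eq_cdot hr e
  have hcd : ∀ x e, cdot (u x) e = polyEval (s e) x := fun x e => by rw [hsu, hu]
  have hum : ∀ m, ContDiff ℝ ∞ fun x => u x m := fun m => by
    rw [hu]; exact contDiff_polyEval (r m)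
  have huc : Continuous u := by
    rw [hu]
    exact (PiLp.continuous_toLp 2 _).comp
      (continuous_pi fun m => (contDiff_polyEval (r m) (n := 0)).continuous)
  have hpc : ∀ q : MvPolynomial (Fin d) ℂ, Continuous (polyEval q) := fun q =>
    (contDiff_polyEval q (n := 0)).continuous
  have hbc : ∀ S, Continuous (bubble B S) := fun S => (contDiff_bubble B S (n := 0)).continuous
  have hint : ∀ {f : Eucl d → ℝ}, Continuous f → IntegrableOn f (openSimplex B) := fun hf =>
    integrableOn_openSimplex B hf
  have hsum : ∀ f : Fin (d + 1) → Fin (d + 1) → Eucl d → ℝ, (∀ i j, Continuous (f i j)) →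
      ∫ x in openSimplex B, ∑ i, ∑ j, f i j x = ∑ i, ∑ j, ∫ x in openSimplex B, f i j x := by
    intro f hf
    rw [integral_finsetSum _ fun i _ => integrable_finsetSum _ fun j _ => hint (hf i j)]
    exact Finset.sum_congr rfl fun i _ => integral_finsetSum _ fun j _ => hint (hf i j)
  have hφ0 : 0 ≤ ∫ x in openSimplex B, ‖polyEval q x‖ ^ 2 :=
    integral_nonneg fun x => by positivity
  have hf : ContDiff ℝ ∞ fun y => (bubble B Finset.univ y : ℂ) * polyEval q y :=
    contDiff_bubble_smul B _ (contDiff_polyEval q)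
  refine ⟨?_, ?_, ?_, ?_⟩
  · refine ((hel B q hq).1).trans (mul_le_mul_of_nonneg_right ?_ ?_)
    · exact le_mul_of_one_le_right hC.le hN
    · exact setIntegral_nonneg hO fun x hx =>
        mul_nonneg (bubble_pos B hx _).le (by positivity)
  · calc ρ ^ 2 * ∫ x in openSimplex B, ‖u x‖ ^ 2
        = ∫ x in openSimplex B, ρ ^ 2 * ‖u x‖ ^ 2 := (integral_const_mul _ _).symm
      _ ≤ ∫ x in openSimplex B, ∑ i, ∑ j, ‖polyEval (s (B i - B j)) x‖ ^ 2 := by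
          refine integral_mono (hint (by fun_prop)) (hint ?_) fun x => ?_
          · exact continuous_finsetSum _ fun i _ => continuous_finsetSum _ fun j _ =>
              (hpc _).norm.pow 2
          · simpa only [hcd] using sq_mul_norm_sq_le_sum_cdot B hρ hball (u x)
      _ = ∑ i, ∑ j, ∫ x in openSimplex B, ‖polyEval (s (B i - B j)) x‖ ^ 2 :=
          hsum _ fun i j => (hpc _).norm.pow 2
      _ ≤ ∑ i, ∑ j, C * ∫ x in openSimplex B,
            bubble B {i, j} x * ‖polyEval (s (B i - B j)) x‖ ^ 2 := by
          refine Finset.sum_le_sum fun i _ => Finset.sum_le_sum fun j _ => ?_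
          refine ((hel B _ (hs _)).1).trans (mul_le_mul_of_nonneg_left ?_ hC.le)
          refine setIntegral_mono_on (hint ((hbc _).mul ((hpc _).norm.pow 2)))
            (hint ((hbc _).mul ((hpc _).norm.pow 2))) hO fun x hx => ?_
          exact mul_le_mul_of_nonneg_right (bubble_univ_le B hx _) (by positivity)
      _ = C * ∫ x in openSimplex B, ∑ i, ∑ j, bubble B {i, j} x * ‖cdot (u x) (B i - B j)‖ ^ 2 := by
          simp only [hcd]
          rw [hsum (fun i j x => bubble B {i, j} x * ‖polyEval (s (B i - B j)) x‖ ^ 2)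
            fun i j => (hbc _).mul ((hpc _).norm.pow 2)]
          simp only [Finset.mul_sum]
      _ ≤ _ := by
          refine mul_le_mul_of_nonneg_right (le_mul_of_one_le_right hC.le hN) ?_
          refine setIntegral_nonneg hO fun x hx => Finset.sum_nonneg fun i _ =>
            Finset.sum_nonneg fun j _ => mul_nonneg (bubble_pos B hx _).le (by positivity)
  · calc _ = ∫ x in openSimplex B, ρ ^ 2 *
            ‖gradC (fun y => (bubble B Finset.univ y : ℂ) * polyEval q y) x‖ ^ 2 :=
          (integral_const_mul _ _).symm
      _ ≤ ∫ x in openSimplex B, ∑ i, ∑ j, ‖fderiv ℝ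
            (fun y => (bubble B Finset.univ y : ℂ) * polyEval q y) x (B i - B j)‖ ^ 2 := by
          refine integral_mono (hint ((continuous_gradC hf).norm.pow 2 |>.const_mul _)) (hint ?_)
            fun x => ?_
          · exact continuous_finsetSum _ fun i _ => continuous_finsetSum _ fun j _ =>
              (continuous_fderiv_apply (hf.of_le (by simp)) _).norm.pow 2
          · simpa only [cdot_gradC] using sq_mul_norm_sq_le_sum_cdot B hρ hball
              (gradC (fun y => (bubble B Finset.univ y : ℂ) * polyEval q y) x)
      _ = ∑ i, ∑ j, ∫ x in openSimplex B, ‖fderiv ℝ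
            (fun y => (bubble B Finset.univ y : ℂ) * polyEval q y) x (B i - B j)‖ ^ 2 :=
          hsum _ fun i j => (continuous_fderiv_apply (hf.of_le (by simp)) _).norm.pow 2
      _ ≤ ∑ i : Fin (d + 1), ∑ j : Fin (d + 1), C * ∫ x in openSimplex B, ‖polyEval q x‖ ^ 2 :=
          Finset.sum_le_sum fun i _ => Finset.sum_le_sum fun j _ => (hel B q hq).2 _ i j
      _ = (C * (d + 1) ^ 2) * ∫ x in openSimplex B, ‖polyEval q x‖ ^ 2 := by
          simp
          ring
      _ ≤ _ := by gcongr
  · have hds : ∀ i j, ContDiff ℝ 1 fun y =>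
        (bubble B {i, j} y : ℂ) * polyEval (s (B i - B j)) y := fun i j =>
      contDiff_bubble_smul B _ (contDiff_polyEval _)
    calc ∫ x in openSimplex B, ‖bubbleFieldDiv B u x‖ ^ 2
        ≤ ∫ x in openSimplex B, ∑ i, ∑ j, (d + 1 : ℝ) ^ 2 * ‖fderiv ℝ
            (fun y => (bubble B {i, j} y : ℂ) * polyEval (s (B i - B j)) y) x (B i - B j)‖ ^ 2 := by
          refine integral_mono (hint ((continuous_bubbleFieldDiv B hum).norm.pow 2)) (hint ?_)
            fun x => ?_
          · exact continuous_finsetSum _ fun i _ => continuous_finsetSum _ fun j _ =>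
              ((continuous_fderiv_apply (hds i j) _).norm.pow 2).const_mul _
          · simp only [bubbleFieldDiv, hcd]
            refine (norm_sum_sum_sq_le _).trans (le_of_eq ?_)
            simp only [Finset.mul_sum]
            push_cast
            rfl
      _ = ∑ i, ∑ j, ∫ x in openSimplex B, (d + 1 : ℝ) ^ 2 * ‖fderiv ℝ
            (fun y => (bubble B {i, j} y : ℂ) * polyEval (s (B i - B j)) y) x (B i - B j)‖ ^ 2 :=
          hsum _ fun i j => ((continuous_fderiv_apply (hds i j) _).norm.pow 2).const_mul _
      _ ≤ ∑ i : Fin (d + 1), ∑ j : Fin (d + 1), (d + 1 : ℝ) ^ 2 *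
            (C * (D ^ 2 * ∫ x in openSimplex B, ‖u x‖ ^ 2)) := by
          refine Finset.sum_le_sum fun i _ => Finset.sum_le_sum fun j _ => ?_
          rw [integral_const_mul]
          refine mul_le_mul_of_nonneg_left ?_ (by positivity)
          refine ((hel B _ (hs _)).2 _ i j).trans (mul_le_mul_of_nonneg_left ?_ hC.le)
          rw [← integral_const_mul]
          refine integral_mono (hint ((hpc _).norm.pow 2)) (hint (by fun_prop)) fun x => ?_
          change ‖polyEval (s (B i - B j)) x‖ ^ 2 ≤ D ^ 2 * ‖u x‖ ^ 2
          rw [← hcd, ← mul_pow, mul_comm D]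
          exact pow_le_pow_left₀ (norm_nonneg _) ((norm_cdot_le _ _).trans
            (mul_le_mul_of_nonneg_left (hD i j) (norm_nonneg _))) 2
      _ = _ := by
          simp
          ring

/-! ### Decomposition of the domain into elements -/

theorem exists_affineBasis_range_eq {K : Finset (Eucl d)} (hcard : K.card = d + 1)
    (hind : AffineIndependent ℝ ((↑) : K → Eucl d)) :
    ∃ B : AffineBasis (Fin (d + 1)) ℝ (Eucl d), Set.range B = (K : Set (Eucl d)) := by
  have htot : affineSpan ℝ (Set.range ((↑) : K → Eucl d)) = ⊤ := by
    rw [hind.affineSpan_eq_top_iff_card_eq_finrank_add_one]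
    simp [hcard]
  let b : AffineBasis K ℝ (Eucl d) := ⟨(↑), hind, htot⟩
  let e : K ≃ Fin (d + 1) := Fintype.equivFinOfCardEq (by simp [hcard])
  refine ⟨b.reindex e, ?_⟩
  rw [AffineBasis.coe_reindex, Set.range_comp, e.symm.surjective.range_eq, Set.image_univ]
  exact Subtype.range_coe

/-- A bounded Lipschitz domain lies locally on one side of its boundary. -/
theorem IsBoundedLipschitzDomain.interior_closure_subset {Ω : Set (Eucl d)}
    (hΩ : IsBoundedLipschitzDomain Ω) : interior (closure Ω) ⊆ Ω := by
  intro x hx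
  by_contra hxΩ
  have hxf : x ∈ frontier Ω := by
    rw [hΩ.isOpen.frontier_eq]
    exact ⟨interior_subset hx, hxΩ⟩
  obtain ⟨e, f, L, r, he, hf, hfe, hr, hΩf⟩ := hΩ.lipschitz x hxf
  have hfx : inner ℝ e x ≤ f x := by
    by_contra h
    exact hxΩ ((hΩf x (Metric.mem_ball_self hr)).2 (not_le.1 h))
  -- Points slightly below the graph of `f` have a neighbourhood that does not meet `Ω`.
  have hcont : Tendsto (fun t : ℝ => x + (-t) • e) (𝓝 0) (𝓝 x) := by
    have : Continuous fun t : ℝ => x + (-t) • e := by fun_prop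
    simpa using this.tendsto 0
  have hev : ∀ᶠ t in 𝓝 (0 : ℝ), x + (-t) • e ∈ closure Ω ∧ x + (-t) • e ∈ Metric.ball x r := by
    have h1 := hcont.eventually (mem_interior_iff_mem_nhds.1 hx)
    have h2 := hcont.eventually (Metric.ball_mem_nhds x hr)
    exact h1.and h2
  obtain ⟨t, ⟨htc, htb⟩, ht0⟩ := ((hev.filter_mono nhdsWithin_le_nhds).and
    (self_mem_nhdsWithin : Set.Ioi (0 : ℝ) ∈ 𝓝[>] 0)).exists
  have hU : IsOpen (Metric.ball x r ∩ {y | inner ℝ e y < f y}) :=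
    Metric.isOpen_ball.inter (isOpen_lt (by fun_prop) hf.continuous)
  have hmem : x + (-t) • e ∈ Metric.ball x r ∩ {y | inner ℝ e y < f y} := by
    refine ⟨htb, ?_⟩
    have ht0' : 0 < t := ht0
    change inner ℝ e (x + (-t) • e) < f (x + (-t) • e)
    rw [hfe, inner_add_right, inner_smul_right, real_inner_self_eq_norm_sq, he]
    linarith
  obtain ⟨y, hy, hyΩ⟩ := mem_closure_iff.1 htc _ hU hmem
  exact lt_asymm ((hΩf y hy.1).1 hyΩ) hy.2

/-- The affine bases `B K` list the vertices of the elements `K ∈ T`, and the open elements are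
disjoint and fill `Ω` up to a null set. -/
structure IsCellDecomposition (Ω : Set (Eucl d)) (T : Finset (Finset (Eucl d)))
    (B : Finset (Eucl d) → AffineBasis (Fin (d + 1)) ℝ (Eucl d)) : Prop where
  range_eq : ∀ K ∈ T, Set.range (B K) = (K : Set (Eucl d))
  subset : ∀ K ∈ T, openSimplex (B K) ⊆ Ω
  notMem : ∀ K ∈ T, ∀ K' ∈ T, K ≠ K' → ∀ x ∈ cell K, x ∉ openSimplex (B K')
  ae_eq : Ω =ᵐ[volume] (⋃ K ∈ T, openSimplex (B K) : Set (Eucl d))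

theorem exists_isCellDecomposition {Ω : Set (Eucl d)} {T : Finset (Finset (Eucl d))}
    (hΩ : IsBoundedLipschitzDomain Ω) (hT : IsConformingMesh Ω T) :
    ∃ B, IsCellDecomposition Ω T B := by
  classical
  have h : ∀ K : Finset (Eucl d), ∃ B : AffineBasis (Fin (d + 1)) ℝ (Eucl d),
      K ∈ T → Set.range B = (K : Set (Eucl d)) := by
    intro K
    by_cases hK : K ∈ T
    · obtain ⟨B, hB⟩ := exists_affineBasis_range_eq (hT.card_eq K hK) (hT.indep K hK)
      exact ⟨B, fun _ => hB⟩
    · obtain ⟨B⟩ : Nonempty (AffineBasis (Fin (d + 1)) ℝ (Eucl d)) :=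
        AffineBasis.exists_affineBasis_of_finiteDimensional (by simp)
      exact ⟨B, fun h => absurd h hK⟩
  choose B hB using h
  have hcell : ∀ K ∈ T, openSimplex (B K) ⊆ cell K := fun K hK => by
    have := openSimplex_subset (B K)
    rwa [hB K hK] at this
  have hsub : ∀ K ∈ T, openSimplex (B K) ⊆ Ω := fun K hK =>
    (interior_maximal ((hcell K hK).trans ((Set.subset_biUnion_of_mem (u := cell) hK).trans
      hT.cover.subset)) (isOpen_openSimplex _)).trans hΩ.interior_closure_subset
  refine ⟨B, hB, hsub, ?_, ?_⟩
  · intro K hK K' hK' hne x hx hx'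
    have hxi : x ∈ convexHull ℝ ((K : Set (Eucl d)) ∩ (K' : Set (Eucl d))) := by
      rw [← hT.conforming K hK K' hK']
      exact ⟨hx, hcell K' hK' hx'⟩
    obtain ⟨a, haK', haK⟩ : ∃ a ∈ K', a ∉ K := by
      by_contra! hcon
      exact hne (Finset.eq_of_subset_of_card_le hcon
        (by rw [hT.card_eq K hK, hT.card_eq K' hK'])).symm
    obtain ⟨i, rfl⟩ : a ∈ Set.range (B K') := by rw [hB K' hK']; exact haK'
    have hzero : convexHull ℝ ((K : Set (Eucl d)) ∩ (K' : Set (Eucl d))) ⊆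
        (B K').coord i ⁻¹' {0} := by
      refine convexHull_min ?_ ((convex_singleton (0 : ℝ)).affine_preimage _)
      rintro y ⟨hyK, hyK'⟩
      obtain ⟨j, rfl⟩ : y ∈ Set.range (B K') := by rw [hB K' hK']; exact hyK'
      have hij : i ≠ j := by
        rintro rfl
        exact haK hyK
      exact (B K').coord_apply_ne hij
    exact (hx' i).ne' (hzero hxi)
  · have h1 : (⋃ K ∈ T, openSimplex (B K)) ⊆ Ω := Set.iUnion₂_subset hsub
    refine Filter.EventuallyLE.antisymm ?_ (Eventually.of_forall h1)
    have h2 : ∀ K ∈ T, ∀ᵐ x ∂(volume : Measure (Eucl d)), x ∈ cell K → x ∈ openSimplex (B K) := by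
      intro K hK
      have := openSimplex_ae_eq (B K)
      rw [hB K hK] at this
      exact this.symm.le
    have h3 := (Finset.eventually_all T).2 h2
    filter_upwards [h3] with x hx hxΩ
    have hxc : x ∈ ⋃ K ∈ T, cell K := by
      rw [hT.cover]
      exact subset_closure hxΩ
    obtain ⟨K, hK, hxK⟩ := Set.mem_iUnion₂.1 hxc
    exact Set.mem_iUnion₂.2 ⟨K, hK, hx K hK hxK⟩

namespace IsCellDecomposition

variable {Ω : Set (Eucl d)} {T : Finset (Finset (Eucl d))}
  {B : Finset (Eucl d) → AffineBasis (Fin (d + 1)) ℝ (Eucl d)}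

theorem openSimplex_subset_cell (hB : IsCellDecomposition Ω T B) {K : Finset (Eucl d)}
    (hK : K ∈ T) : openSimplex (B K) ⊆ cell K := by
  have := openSimplex_subset (B K)
  rwa [hB.range_eq K hK] at this

theorem cell_ae_eq (hB : IsCellDecomposition Ω T B) {K : Finset (Eucl d)} (hK : K ∈ T) :
    openSimplex (B K) =ᵐ[volume] cell K := by
  have := openSimplex_ae_eq (B K)
  rwa [hB.range_eq K hK] at this

theorem ae_restrict_of_ae_cell (hB : IsCellDecomposition Ω T B) {K : Finset (Eucl d)} (hK : K ∈ T)
    {P : Eucl d → Prop} (h : ∀ᵐ x ∂(volume.restrict Ω), x ∈ cell K → P x) :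
    ∀ᵐ x ∂(volume.restrict (openSimplex (B K))), P x := by
  have h1 := ae_mono (Measure.restrict_mono_set volume (hB.subset K hK)) h
  filter_upwards [h1, ae_restrict_mem (isOpen_openSimplex (B K)).measurableSet] with x hx hxO
  exact hx (hB.openSimplex_subset_cell hK hxO)

theorem ae_cell_of_ae_restrict (hB : IsCellDecomposition Ω T B) {K : Finset (Eucl d)} (hK : K ∈ T)
    {P : Eucl d → Prop} (h : ∀ᵐ x ∂(volume.restrict (openSimplex (B K))), P x) :
    ∀ᵐ x ∂(volume.restrict Ω), x ∈ cell K → P x := by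
  rw [ae_restrict_iff' (isOpen_openSimplex (B K)).measurableSet] at h
  refine ae_restrict_of_ae ?_
  filter_upwards [h, (hB.cell_ae_eq hK).symm.le] with x hx hc hxK
  exact hx (hc hxK)

theorem ae_of_forall_cell (hB : IsCellDecomposition Ω T B) {P : Eucl d → Prop}
    (h : ∀ K ∈ T, ∀ᵐ x ∂(volume.restrict (openSimplex (B K))), P x) :
    ∀ᵐ x ∂(volume.restrict Ω), P x := by
  rw [Measure.restrict_congr_set hB.ae_eq]
  have := (ae_restrict_biUnion_finset_iff (μ := (volume : Measure (Eucl d)))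
    (fun K => openSimplex (B K)) T P).2 h
  exact this

theorem pairwise_disjoint (hB : IsCellDecomposition Ω T B) :
    Set.Pairwise (T : Set (Finset (Eucl d)))
      (Function.onFun Disjoint fun K => openSimplex (B K)) := by
  intro K hK K' hK' hne
  exact Set.disjoint_left.2 fun x hx hx' =>
    hB.notMem K hK K' hK' hne x (hB.openSimplex_subset_cell hK hx) hx'

theorem setIntegral_eq_sum (hB : IsCellDecomposition Ω T B) {E : Type*} [NormedAddCommGroup E]
    [NormedSpace ℝ E] {F : Eucl d → E} {f : Finset (Eucl d) → Eucl d → E}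
    (hF : ∀ K ∈ T, F =ᵐ[volume.restrict (openSimplex (B K))] f K)
    (hf : ∀ K ∈ T, IntegrableOn (f K) (openSimplex (B K))) :
    ∫ x in Ω, F x = ∑ K ∈ T, ∫ x in openSimplex (B K), f K x := by
  rw [setIntegral_congr_set hB.ae_eq, integral_biUnion_finset T
    (fun K _ => (isOpen_openSimplex (B K)).measurableSet) hB.pairwise_disjoint
    (fun K hK => (hf K hK).congr (hF K hK).symm)]
  exact Finset.sum_congr rfl fun K hK => integral_congr_ae (hF K hK)

/-- Functions which are continuous up to the boundary on each element define elements of `L₂(Ω)`. -/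
theorem exists_lp (hB : IsCellDecomposition Ω T B) {E : Type*} [NormedAddCommGroup E]
    {f : Finset (Eucl d) → Eucl d → E} (hf : ∀ K ∈ T, Continuous (f K)) :
    ∃ z : Lp E 2 (volume.restrict Ω), ∀ K ∈ T,
      z =ᵐ[volume.restrict (openSimplex (B K))] f K := by
  classical
  let F : Eucl d → E := fun x => ∑ K ∈ T, (openSimplex (B K)).indicator (f K) x
  have hFm : MemLp F 2 (volume.restrict Ω) := by
    refine memLp_finsetSum _ fun K hK => ?_
    rw [memLp_indicator_iff_restrict (isOpen_openSimplex (B K)).measurableSet]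
    exact (memLp_openSimplex (B K) (hf K hK)).mono_measure
      (Measure.restrict_mono_measure Measure.restrict_le_self _)
  refine ⟨hFm.toLp F, fun K hK => ?_⟩
  have h1 : hFm.toLp F =ᵐ[volume.restrict (openSimplex (B K))] F :=
    ae_mono (Measure.restrict_mono_set volume (hB.subset K hK)) hFm.coeFn_toLp
  refine h1.trans ((ae_restrict_mem (isOpen_openSimplex (B K)).measurableSet).mono fun x hx => ?_)
  change ∑ K ∈ T, (openSimplex (B K)).indicator (f K) x = f K x
  rw [Finset.sum_eq_single_of_mem K hK, Set.indicator_of_mem hx]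
  intro K' hK' hne
  exact Set.indicator_of_notMem
    (hB.notMem K hK K' hK' hne.symm x (hB.openSimplex_subset_cell hK hx)) _

theorem norm_sq_lp (hB : IsCellDecomposition Ω T B) {E : Type*} [NormedAddCommGroup E]
    [InnerProductSpace ℂ E] {f : Finset (Eucl d) → Eucl d → E} (hf : ∀ K ∈ T, Continuous (f K))
    {z : Lp E 2 (volume.restrict Ω)}
    (hz : ∀ K ∈ T, z =ᵐ[volume.restrict (openSimplex (B K))] f K) :
    ‖z‖ ^ 2 = ∑ K ∈ T, ∫ x in openSimplex (B K), ‖f K x‖ ^ 2 := by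
  have h := norm_toLp_sq (Lp.memLp z)
  rw [Lp.toLp_coeFn] at h
  rw [h]
  refine hB.setIntegral_eq_sum (fun K hK => ?_) fun K hK =>
    integrableOn_openSimplex (B K) ((hf K hK).norm.pow 2)
  filter_upwards [hz K hK] with x hx
  rw [hx]

theorem inner_lp (hB : IsCellDecomposition Ω T B) {E : Type*} [NormedAddCommGroup E]
    [InnerProductSpace ℂ E] {f g : Finset (Eucl d) → Eucl d → E}
    (hf : ∀ K ∈ T, Continuous (f K)) (hg : ∀ K ∈ T, Continuous (g K))
    {z w : Lp E 2 (volume.restrict Ω)}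
    (hz : ∀ K ∈ T, z =ᵐ[volume.restrict (openSimplex (B K))] f K)
    (hw : ∀ K ∈ T, w =ᵐ[volume.restrict (openSimplex (B K))] g K) :
    inner ℂ z w = ∑ K ∈ T, ∫ x in openSimplex (B K), inner ℂ (f K x) (g K x) := by
  rw [L2.inner_def]
  refine hB.setIntegral_eq_sum (fun K hK => ?_) fun K hK =>
    integrableOn_openSimplex (B K) ((hf K hK).inner (hg K hK))
  filter_upwards [hz K hK, hw K hK] with x hx hx'
  rw [hx, hx']

end IsCellDecomposition

/-! ### Weak derivatives on the domain -/

theorem IsTestFunction.mono {O Ω : Set (Eucl d)} (h : O ⊆ Ω) {χ : Eucl d → ℝ}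
    (hχ : IsTestFunction O χ) : IsTestFunction Ω χ :=
  ⟨hχ.1, hχ.2.1, hχ.2.2.trans h⟩

theorem integrable_lp {Ω : Set (Eucl d)} (hΩ : Bornology.IsBounded Ω) {E : Type*}
    [NormedAddCommGroup E] (z : Lp E 2 (volume.restrict Ω)) : IntegrableOn z Ω := by
  have : IsFiniteMeasure (volume.restrict Ω) := ⟨by simpa using hΩ.measure_lt_top⟩
  exact (Lp.memLp z).integrable one_le_two

theorem integrableOn_mul_ofReal {Ω : Set (Eucl d)} {a : Eucl d → ℂ} (ha : IntegrableOn a Ω)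
    {χ : Eucl d → ℝ} (hχ : Continuous χ) (hs : HasCompactSupport χ) :
    IntegrableOn (fun x => a x * (χ x : ℂ)) Ω := by
  obtain ⟨M, hM⟩ := hs.exists_bound_of_continuous hχ
  exact Integrable.mul_bdd ha (c := M) (Complex.continuous_ofReal.comp hχ).aestronglyMeasurable
    (ae_of_all _ fun x => by simpa using hM x)

theorem ae_eq_zero_of_integral_test {Ω : Set (Eucl d)} (hΩ : IsOpen Ω) {f : Eucl d → ℂ}
    (hf : IntegrableOn f Ω)
    (h : ∀ χ, IsTestFunction Ω χ → ∫ x in Ω, f x * (χ x : ℂ) = 0) :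
    ∀ᵐ x ∂(volume.restrict Ω), f x = 0 := by
  rw [ae_restrict_iff' hΩ.measurableSet]
  refine hΩ.ae_eq_zero_of_integral_contDiff_smul_eq_zero hf.locallyIntegrableOn
    fun χ h1 h2 h3 => ?_
  have := h χ ⟨h1, h2, h3⟩
  rw [setIntegral_mul_test ⟨h1, h2, h3⟩] at this
  simpa [mul_comm] using this

theorem MemH1.hasWeakGrad {Ω : Set (Eucl d)} {η : L2 Ω} (h : MemH1 η) :
    HasWeakGrad η (weakGrad η) := by
  have hex : ∃ g, HasWeakGrad η g := h
  rw [weakGrad, dif_pos hex]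
  exact hex.choose_spec

theorem HasWeakGrad.weakGrad_eq {Ω : Set (Eucl d)} (hΩ : IsOpen Ω) (hb : Bornology.IsBounded Ω)
    {η : L2 Ω} {g : L2Vec Ω} (hg : HasWeakGrad η g) : weakGrad η = g := by
  have h1 : HasWeakGrad η (weakGrad η) := MemH1.hasWeakGrad ⟨g, hg⟩
  have hcomp : ∀ (z : L2Vec Ω) i, IntegrableOn (fun x => z x i) Ω := fun z i =>
    (EuclideanSpace.proj i : CVec d →L[ℂ] ℂ).integrable_comp (integrable_lp hb z)
  have h2 : ∀ i : Fin d, ∀ᵐ x ∂(volume.restrict Ω), weakGrad η x i - g x i = 0 := by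
    intro i
    refine ae_eq_zero_of_integral_test hΩ ((hcomp _ i).sub (hcomp g i)) fun χ hχ => ?_
    simp only [sub_mul]
    rw [integral_sub (integrableOn_mul_ofReal (hcomp _ i) hχ.1.continuous hχ.2.1)
      (integrableOn_mul_ofReal (hcomp g i) hχ.1.continuous hχ.2.1)]
    have e1 := h1 χ hχ i
    have e2 := hg χ hχ i
    rw [e1] at e2
    rw [neg_injective e2, sub_self]
  apply Lp.ext
  filter_upwards [ae_all_iff.2 h2] with x hx
  ext i
  exact sub_eq_zero.1 (hx i)

theorem HasWeakDiv.weakDiv_eq {Ω : Set (Eucl d)} (hΩ : IsOpen Ω) (hb : Bornology.IsBounded Ω)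
    {v : L2Vec Ω} {w : L2 Ω} (hw : HasWeakDiv v w) : weakDiv v = w := by
  have hex : ∃ w, HasWeakDiv v w := ⟨w, hw⟩
  have h1 : HasWeakDiv v (weakDiv v) := by
    rw [weakDiv, dif_pos hex]
    exact hex.choose_spec
  have h2 : ∀ᵐ x ∂(volume.restrict Ω), weakDiv v x - w x = 0 := by
    refine ae_eq_zero_of_integral_test hΩ ((integrable_lp hb _).sub (integrable_lp hb w))
      fun χ hχ => ?_
    simp only [sub_mul]
    rw [integral_sub (integrableOn_mul_ofReal (integrable_lp hb _) hχ.1.continuous hχ.2.1)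
      (integrableOn_mul_ofReal (integrable_lp hb w) hχ.1.continuous hχ.2.1)]
    have e1 := h1 χ hχ
    have e2 := hw χ hχ
    rw [e1] at e2
    rw [neg_injective e2, sub_self]
  apply Lp.ext
  filter_upwards [h2] with x hx
  exact sub_eq_zero.1 hx

/-- The complex conjugate of a vector. -/
noncomputable def conjVec (u : CVec d) : CVec d := WithLp.toLp 2 fun m => starRingEnd ℂ (u m)

theorem cdot_conjVec (u : CVec d) (e : Eucl d) :
    cdot (conjVec u) e = starRingEnd ℂ (cdot u e) := by
  simp [cdot, conjVec]

theorem HasWeakDirDeriv.conj {O : Set (Eucl d)} {e : Eucl d} {ψ G : Eucl d → ℂ}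
    (h : HasWeakDirDeriv O e ψ G) :
    HasWeakDirDeriv O e (fun x => starRingEnd ℂ (ψ x)) fun x => starRingEnd ℂ (G x) := by
  intro ξ hξ
  have h1 := congrArg (starRingEnd ℂ) (h ξ hξ)
  rw [map_neg, ← integral_conj, ← integral_conj] at h1
  simpa using h1

/-- Weak gradients restrict to open subsets, and determine all directional derivatives. -/
theorem HasWeakGrad.hasWeakDirDeriv {Ω O : Set (Eucl d)} (hb : Bornology.IsBounded Ω) (hO : O ⊆ Ω)
    {η : L2 Ω} {g : L2Vec Ω} (hg : HasWeakGrad η g) (e : Eucl d) :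
    HasWeakDirDeriv O e η fun x => cdot (g x) e := by
  intro ξ hξ
  have hξΩ := hξ.mono hO
  rw [setIntegral_mul_fderiv_test hξ, setIntegral_mul_test hξ,
    ← setIntegral_mul_fderiv_test hξΩ, ← setIntegral_mul_test hξΩ]
  have hcomp : ∀ i, IntegrableOn (fun x => g x i) Ω := fun i =>
    (EuclideanSpace.proj i : CVec d →L[ℂ] ℂ).integrable_comp (integrable_lp hb g)
  have hdc : ∀ m, Continuous fun x => partialDeriv m ξ x := fun m =>
    (hξ.1.continuous_fderiv (by simp)).clm_apply continuous_const
  have hds : ∀ m, HasCompactSupport fun x => partialDeriv m ξ x := fun m =>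
    hξ.2.1.fderiv_apply ℝ _
  have h1 : ∀ x, η x * (fderiv ℝ ξ x e : ℂ) =
      ∑ m, (e m : ℂ) * (η x * (partialDeriv m ξ x : ℂ)) := by
    intro x
    rw [clm_apply_eq_sum]
    simp only [smul_eq_mul]
    push_cast
    rw [Finset.mul_sum]
    refine Finset.sum_congr rfl fun m _ => ?_
    rw [partialDeriv]
    ring
  have h2 : ∀ x, cdot (g x) e * (ξ x : ℂ) = ∑ m, (e m : ℂ) * (g x m * (ξ x : ℂ)) := by
    intro x
    rw [cdot, Finset.sum_mul]
    refine Finset.sum_congr rfl fun m _ => ?_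
    ring
  simp only [h1, h2]
  rw [integral_finsetSum _ fun m _ =>
      (integrableOn_mul_ofReal (integrable_lp hb η) (hdc m) (hds m)).const_mul _,
    integral_finsetSum _ fun m _ =>
      (integrableOn_mul_ofReal (hcomp m) hξ.1.continuous hξ.2.1).const_mul _,
    ← Finset.sum_neg_distrib]
  refine Finset.sum_congr rfl fun m _ => ?_
  rw [integral_const_mul, integral_const_mul, hg ξ hξΩ m, mul_neg]

/-! ### The test functions belong to the test space -/

namespace IsCellDecomposition

variable {Ω : Set (Eucl d)} {T : Finset (Finset (Eucl d))}
  {B : Finset (Eucl d) → AffineBasis (Fin (d + 1)) ℝ (Eucl d)}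

theorem hasWeakGrad_bubble (hB : IsCellDecomposition Ω T B) {f : Finset (Eucl d) → Eucl d → ℂ}
    (hf : ∀ K ∈ T, ContDiff ℝ ∞ (f K)) {η : L2 Ω} {g : L2Vec Ω}
    (hη : ∀ K ∈ T, η =ᵐ[volume.restrict (openSimplex (B K))]
      fun x => (bubble (B K) Finset.univ x : ℂ) * f K x)
    (hg : ∀ K ∈ T, g =ᵐ[volume.restrict (openSimplex (B K))]
      gradC fun x => (bubble (B K) Finset.univ x : ℂ) * f K x) : HasWeakGrad η g := by
  intro χ hχ i
  have hsm : ∀ K ∈ T, ContDiff ℝ ∞ fun x => (bubble (B K) Finset.univ x : ℂ) * f K x :=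
    fun K hK => contDiff_bubble_smul _ _ (hf K hK)
  have hdc : Continuous fun x => (partialDeriv i χ x : ℂ) := Complex.continuous_ofReal.comp
    ((hχ.1.continuous_fderiv (by simp)).clm_apply continuous_const)
  have hχc : Continuous fun x => (χ x : ℂ) := Complex.continuous_ofReal.comp hχ.1.continuous
  rw [hB.setIntegral_eq_sum (f := fun K x =>
      (partialDeriv i χ x : ℂ) * ((bubble (B K) Finset.univ x : ℂ) * f K x))
      (fun K hK => by filter_upwards [hη K hK] with x hx; rw [hx, mul_comm])
      (fun K hK => integrableOn_openSimplex _ (hdc.mul (hsm K hK).continuous)),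
    hB.setIntegral_eq_sum (f := fun K x => (χ x : ℂ) *
      fderiv ℝ (fun x => (bubble (B K) Finset.univ x : ℂ) * f K x) x (EuclideanSpace.single i 1))
      (fun K hK => by filter_upwards [hg K hK] with x hx; rw [hx, mul_comm, gradC_apply])
      (fun K hK => integrableOn_openSimplex _ (hχc.mul
        (continuous_fderiv_apply ((hsm K hK).of_le (by simp)) _))), ← Finset.sum_neg_distrib]
  refine Finset.sum_congr rfl fun K hK => ?_
  rw [integral_mul_fderiv_bubble (B K) Finset.univ (fun k hk => absurd (Finset.mem_univ k) hk)
    (integrableOn_openSimplex _ hχc) (integrableOn_openSimplex _ hdc)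
    (hasWeakDirDeriv_of_contDiff _ _ hχ.1) (hf K hK), neg_neg]

theorem hasWeakDiv_bubbleField (hB : IsCellDecomposition Ω T B)
    {u : Finset (Eucl d) → Eucl d → CVec d} (hu : ∀ K ∈ T, ∀ m, ContDiff ℝ ∞ fun x => u K x m)
    {v : L2Vec Ω} {w : L2 Ω}
    (hv : ∀ K ∈ T, v =ᵐ[volume.restrict (openSimplex (B K))] bubbleField (B K) (u K))
    (hw : ∀ K ∈ T, w =ᵐ[volume.restrict (openSimplex (B K))] bubbleFieldDiv (B K) (u K)) :
    HasWeakDiv v w := by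
  intro χ hχ
  have hχC : ContDiff ℝ ∞ fun x => (χ x : ℂ) := Complex.ofRealCLM.contDiff.comp hχ.1
  have hd : ∀ x e, fderiv ℝ (fun x => (χ x : ℂ)) x e = (fderiv ℝ χ x e : ℂ) := by
    intro x e
    have h := (Complex.ofRealCLM.hasFDerivAt (x := χ x)).comp x
      ((hχ.1.differentiable (by simp)) x).hasFDerivAt
    exact congrArg (fun A : Eucl d →L[ℝ] ℂ => A e) h.fderiv
  have hbf : ∀ K ∈ T, Continuous fun x =>
      ∑ m, bubbleField (B K) (u K) x m * gradC (fun x => (χ x : ℂ)) x m := fun K hK =>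
    continuous_finsetSum _ fun m _ =>
      ((EuclideanSpace.proj m : CVec d →L[ℂ] ℂ).continuous.comp
        (continuous_bubbleField (B K) (hu K hK))).mul
      ((EuclideanSpace.proj m : CVec d →L[ℂ] ℂ).continuous.comp (continuous_gradC hχC))
  rw [hB.setIntegral_eq_sum (f := fun K x =>
      ∑ m, bubbleField (B K) (u K) x m * gradC (fun x => (χ x : ℂ)) x m)
      (fun K hK => by
        filter_upwards [hv K hK] with x hx
        rw [hx]
        refine Finset.sum_congr rfl fun m _ => ?_
        rw [gradC_apply, hd, partialDeriv])
      (fun K hK => integrableOn_openSimplex _ (hbf K hK)),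
    hB.setIntegral_eq_sum (f := fun K x => bubbleFieldDiv (B K) (u K) x * (χ x : ℂ))
      (fun K hK => by filter_upwards [hw K hK] with x hx; rw [hx])
      (fun K hK => integrableOn_openSimplex _
        ((continuous_bubbleFieldDiv (B K) (hu K hK)).mul hχC.continuous)),
    ← Finset.sum_neg_distrib]
  refine Finset.sum_congr rfl fun K hK => ?_
  refine integral_bubbleField (B K) (hu K hK) (integrableOn_openSimplex _ hχC.continuous)
    (integrableOn_openSimplex _ (continuous_gradC hχC)) fun e => ?_
  have := hasWeakDirDeriv_of_contDiff (openSimplex (B K)) e hχ.1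
  simpa only [cdot_gradC, hd] using this

/-- The normal trace of the piecewise bubble field vanishes on the boundary. -/
theorem normalPairing_bubbleField (hB : IsCellDecomposition Ω T B) (hΩ : IsOpen Ω)
    (hb : Bornology.IsBounded Ω)
    {u : Finset (Eucl d) → Eucl d → CVec d} (hu : ∀ K ∈ T, ∀ m, ContDiff ℝ ∞ fun x => u K x m)
    {v : L2Vec Ω} {w : L2 Ω}
    (hv : ∀ K ∈ T, v =ᵐ[volume.restrict (openSimplex (B K))] bubbleField (B K) (u K))
    (hw : ∀ K ∈ T, w =ᵐ[volume.restrict (openSimplex (B K))] bubbleFieldDiv (B K) (u K))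
    {ψ : L2 Ω} (hψ : MemH1 ψ) : normalPairing v ψ = 0 := by
  have hdiv : weakDiv v = w := (hB.hasWeakDiv_bubbleField hu hv hw).weakDiv_eq hΩ hb
  have hψi : ∀ K ∈ T, IntegrableOn (fun x => starRingEnd ℂ (ψ x)) (openSimplex (B K)) := by
    intro K hK
    have := (integrable_lp hb ψ).mono_set (hB.subset K hK)
    exact (Complex.conjCLE.toContinuousLinearMap).integrable_comp this
  have hGi : ∀ K ∈ T, IntegrableOn (fun x => conjVec (weakGrad ψ x)) (openSimplex (B K)) := by
    intro K hK
    have h1 := (integrable_lp hb (weakGrad ψ)).mono_set (hB.subset K hK)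
    refine h1.norm.mono' ?_ (ae_of_all _ fun x => ?_)
    · have hc : Continuous (conjVec : CVec d → CVec d) := by
        unfold conjVec
        exact (PiLp.continuous_toLp 2 _).comp (continuous_pi fun m =>
          Complex.continuous_conj.comp (EuclideanSpace.proj m : CVec d →L[ℂ] ℂ).continuous)
      exact hc.comp_aestronglyMeasurable h1.aestronglyMeasurable
    · simp [EuclideanSpace.norm_eq, conjVec]
  have hbd : ∀ K, ∀ {a b : Eucl d → ℂ}, IntegrableOn a (openSimplex (B K)) → Continuous b →
      IntegrableOn (fun x => b x * a x) (openSimplex (B K)) := by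
    intro K a b ha hb
    obtain ⟨M, hM⟩ := (isCompact_simplex (B K)).exists_bound_of_continuousOn hb.continuousOn
    refine Integrable.bdd_mul ha (c := M) hb.aestronglyMeasurable ?_
    exact (ae_restrict_mem (isOpen_openSimplex (B K)).measurableSet).mono fun x hx =>
      hM x (openSimplex_subset (B K) hx)
  have hi1 : ∀ K ∈ T, IntegrableOn (fun x => ∑ m, bubbleField (B K) (u K) x m *
      conjVec (weakGrad ψ x) m) (openSimplex (B K)) := fun K hK =>
    integrable_finsetSum _ fun m _ => hbd K
      ((EuclideanSpace.proj m : CVec d →L[ℂ] ℂ).integrable_comp (hGi K hK))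
      ((EuclideanSpace.proj m : CVec d →L[ℂ] ℂ).continuous.comp
        (continuous_bubbleField (B K) (hu K hK)))
  have hi2 : ∀ K ∈ T, IntegrableOn (fun x => bubbleFieldDiv (B K) (u K) x *
      starRingEnd ℂ (ψ x)) (openSimplex (B K)) := fun K hK =>
    hbd K (hψi K hK) (continuous_bubbleFieldDiv (B K) (hu K hK))
  rw [normalPairing, hdiv, hB.setIntegral_eq_sum (f := fun K x =>
      (∑ m, bubbleField (B K) (u K) x m * conjVec (weakGrad ψ x) m) +
        bubbleFieldDiv (B K) (u K) x * starRingEnd ℂ (ψ x))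
      (fun K hK => by
        filter_upwards [hv K hK, hw K hK] with x hx hx'
        rw [hx, hx']
        simp [PiLp.inner_apply, conjVec])
      (fun K hK => (hi1 K hK).add (hi2 K hK))]
  refine Finset.sum_eq_zero fun K hK => ?_
  rw [integral_add (hi1 K hK) (hi2 K hK),
    integral_bubbleField (B K) (hu K hK) (hψi K hK) (hGi K hK) fun e => ?_, neg_add_cancel]
  have := (hψ.hasWeakGrad.hasWeakDirDeriv hb (hB.subset K hK) e).conj
  simpa only [cdot_conjVec] using this

end IsCellDecomposition

/-- The bubble of a simplex, extended by zero to a continuous function on the whole space. -/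
noncomputable def extBubble (B : AffineBasis (Fin (d + 1)) ℝ (Eucl d)) (x : Eucl d) : ℝ :=
  ∏ k, max (B.coord k x) 0

theorem continuous_extBubble (B : AffineBasis (Fin (d + 1)) ℝ (Eucl d)) :
    Continuous (extBubble B) :=
  continuous_finsetProd _ fun k _ =>
    (contDiff_coord B k (n := 0)).continuous.max continuous_const

theorem extBubble_eq_zero (B : AffineBasis (Fin (d + 1)) ℝ (Eucl d)) {x : Eucl d}
    (hx : x ∉ openSimplex B) : extBubble B x = 0 := by
  simp only [openSimplex, Set.mem_ofPred_eq, not_forall, not_lt] at hx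
  obtain ⟨k, hk⟩ := hx
  exact Finset.prod_eq_zero (Finset.mem_univ k) (max_eq_right hk)

theorem extBubble_eq (B : AffineBasis (Fin (d + 1)) ℝ (Eucl d)) {x : Eucl d}
    (hx : x ∈ openSimplex B) : extBubble B x = bubble B Finset.univ x :=
  Finset.prod_congr rfl fun k _ => max_eq_left (hx k).le

theorem polyEval_prod_affinePoly {ι : Type*} (s : Finset ι) (ℓ : ι → Eucl d →ᵃ[ℝ] ℝ)
    (q : MvPolynomial (Fin d) ℂ) (x : Eucl d) :
    polyEval ((∏ k ∈ s, affinePoly (ℓ k)) * q) x = ((∏ k ∈ s, ℓ k x : ℝ) : ℂ) * polyEval q x := by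
  have h : ∀ k, MvPolynomial.eval (fun i => (x i : ℂ)) (affinePoly (ℓ k)) = (ℓ k x : ℂ) :=
    fun k => polyEval_affinePoly (ℓ k) x
  simp [polyEval, h]

/-- In terms of the field `2 ∑ᵢ λᵢ (u · aᵢ) (aᵢ - x)`, the bubble field is seen to be a
Raviart-Thomas field: only its last term exceeds the degree of `λᵢ u`, and it is parallel to `x`. -/
theorem bubbleField_apply (B : AffineBasis (Fin (d + 1)) ℝ (Eucl d)) (u : Eucl d → CVec d)
    (x : Eucl d) (m : Fin d) : bubbleField B u x m =
      2 * ∑ i, (B.coord i x : ℂ) * cdot (u x) (B i) * (B i m : ℂ) -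
        x m * (2 * ∑ i, (B.coord i x : ℂ) * cdot (u x) (B i)) := by
  have hsub : ∀ i j, cdot (u x) (B i - B j) = cdot (u x) (B i) - cdot (u x) (B j) := by
    intro i j
    simp [cdot, mul_sub]
  have hterm : ∀ i j, (((bubble B {i, j} x : ℂ) * cdot (u x) (B i - B j)) • cvec (B i - B j)) m =
      (B.coord i x : ℂ) * (B.coord j x : ℂ) * (cdot (u x) (B i) - cdot (u x) (B j)) *
        ((B i m : ℂ) - (B j m : ℂ)) := by
    intro i j
    rcases eq_or_ne i j with rfl | hij
    · simp
    · have hb : bubble B {i, j} x = B.coord i x * B.coord j x := Finset.prod_pair hij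
      rw [hb, hsub]
      simp only [PiLp.smul_apply, cvec_apply, smul_eq_mul, PiLp.sub_apply]
      push_cast
      rfl
  have h1 : ∑ i, (B.coord i x : ℂ) = 1 := by
    exact_mod_cast B.sum_coord_apply_eq_one x
  have hx : ∑ i, (B.coord i x : ℂ) * (B i m : ℂ) = x m := by
    have h := congrArg (fun y : Eucl d => y m) (B.linear_combination_coord_eq_self x)
    simp only [WithLp.ofLp_sum, Finset.sum_apply, PiLp.smul_apply, smul_eq_mul] at h
    exact_mod_cast h
  have hL : bubbleField B u x m = ∑ i, ∑ j, (B.coord i x : ℂ) * (B.coord j x : ℂ) *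
      (cdot (u x) (B i) - cdot (u x) (B j)) * ((B i m : ℂ) - (B j m : ℂ)) := by
    rw [bubbleField]
    simp only [WithLp.ofLp_sum, Finset.sum_apply]
    exact Finset.sum_congr rfl fun i _ => Finset.sum_congr rfl fun j _ => hterm i j
  rw [hL]
  generalize hc : (fun i => cdot (u x) (B i)) = c
  generalize ha : (fun i => (B i m : ℂ)) = a at hx
  generalize hl : (fun i => (B.coord i x : ℂ)) = l at hx h1
  have hc' : ∀ i, cdot (u x) (B i) = c i := fun i => congrFun hc i
  have ha' : ∀ i, (B i m : ℂ) = a i := fun i => congrFun ha i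
  have hl' : ∀ i, (B.coord i x : ℂ) = l i := fun i => congrFun hl i
  simp only [hc', ha', hl'] at hx h1 ⊢
  have hexp : ∀ i j, l i * l j * (c i - c j) * (a i - a j) =
      l i * c i * a i * l j + l i * (l j * c j * a j) - l i * c i * (l j * a j)
        - l i * a i * (l j * c j) := fun i j => by ring
  simp only [hexp, Finset.sum_add_distrib, Finset.sum_sub_distrib, ← Finset.mul_sum,
    ← Finset.sum_mul, h1, hx]
  ring

/-- Splitting off the part of highest degree. -/
theorem exists_homogeneous_add {k : ℕ} {R : MvPolynomial (Fin d) ℂ} (hR : R.totalDegree ≤ k + 1) :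
    ∃ r r' : MvPolynomial (Fin d) ℂ, r.IsHomogeneous (k + 1) ∧ r'.totalDegree ≤ k ∧ R = r + r' := by
  refine ⟨MvPolynomial.homogeneousComponent (k + 1) R,
    ∑ i ∈ Finset.range (k + 1), MvPolynomial.homogeneousComponent i R,
    MvPolynomial.homogeneousComponent_isHomogeneous _ _, ?_, ?_⟩
  · refine MvPolynomial.totalDegree_finsetSum_le fun i hi => ?_
    exact (MvPolynomial.homogeneousComponent_isHomogeneous i R).totalDegree_le.trans
      (Nat.lt_succ_iff.1 (Finset.mem_range.1 hi))
  · rw [add_comm, ← Finset.sum_range_succ]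
    conv_lhs => rw [← MvPolynomial.sum_homogeneousComponent R]
    refine Finset.sum_subset (Finset.range_mono (by omega)) fun i _ hi => ?_
    refine MvPolynomial.homogeneousComponent_eq_zero _ _ ?_
    rw [Finset.mem_range] at hi
    omega

theorem exists_raviartThomas_form (B : AffineBasis (Fin (d + 1)) ℝ (Eucl d)) {p : ℕ}
    {r : Fin d → MvPolynomial (Fin d) ℂ} (hr : ∀ m, (r m).totalDegree ≤ p) {u : Eucl d → CVec d}
    (hu : u = fun x => WithLp.toLp 2 fun m => polyEval (r m) x) :
    ∃ (q : Fin d → MvPolynomial (Fin d) ℂ) (R : MvPolynomial (Fin d) ℂ),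
      (∀ m, (q m).totalDegree ≤ p + 1) ∧ R.IsHomogeneous (p + 1) ∧
        ∀ x m, bubbleField B u x m = polyEval (q m) x + (x m : ℂ) * polyEval R x := by
  choose s hs hsu using fun e => exists_polyEval_eq_cdot hr e
  let t : Fin (d + 1) → MvPolynomial (Fin d) ℂ := fun i => affinePoly (B.coord i) * s (B i)
  have ht : ∀ i, (t i).totalDegree ≤ p + 1 := fun i => by
    refine (MvPolynomial.totalDegree_mul _ _).trans ?_
    rw [add_comm]
    exact add_le_add (hs _) (totalDegree_affinePoly_le _)
  have hte : ∀ i x, polyEval (t i) x = (B.coord i x : ℂ) * cdot (u x) (B i) := by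
    intro i x
    rw [hu, ← hsu, ← polyEval_affinePoly]
    simp [t, polyEval]
  have hR : (-(MvPolynomial.C 2 * ∑ i, t i)).totalDegree ≤ p + 1 := by
    rw [MvPolynomial.totalDegree_neg]
    refine (MvPolynomial.totalDegree_mul _ _).trans ?_
    rw [MvPolynomial.totalDegree_C, zero_add]
    exact MvPolynomial.totalDegree_finsetSum_le fun i _ => ht i
  obtain ⟨R, R', hRh, hR', hRR⟩ := exists_homogeneous_add hR
  refine ⟨fun m => MvPolynomial.C 2 * ∑ i, t i * MvPolynomial.C (B i m : ℂ) +
    MvPolynomial.X m * R', R, fun m => ?_, hRh, fun x m => ?_⟩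
  · refine (MvPolynomial.totalDegree_add _ _).trans (max_le ?_ ?_)
    · refine (MvPolynomial.totalDegree_mul _ _).trans ?_
      rw [MvPolynomial.totalDegree_C, zero_add]
      refine MvPolynomial.totalDegree_finsetSum_le fun i _ => ?_
      exact (MvPolynomial.totalDegree_mul _ _).trans (by simpa using ht i)
    · refine (MvPolynomial.totalDegree_mul _ _).trans ?_
      rw [MvPolynomial.totalDegree_X, add_comm]
      exact add_le_add hR' le_rfl
  · have h1 := congrArg (fun P => polyEval P x) hRR
    simp only [polyEval, map_add, map_neg, map_mul, map_sum, MvPolynomial.eval_C,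
      MvPolynomial.eval_X] at h1 ⊢
    have hte' : ∀ i, MvPolynomial.eval (fun i => (x i : ℂ)) (t i) =
      (B.coord i x : ℂ) * cdot (u x) (B i) := fun i => hte i x
    simp only [hte'] at h1 ⊢
    rw [bubbleField_apply]
    linear_combination (x m : ℂ) * h1

namespace IsCellDecomposition

variable {Ω : Set (Eucl d)} {T : Finset (Finset (Eucl d))}
  {B : Finset (Eucl d) → AffineBasis (Fin (d + 1)) ℝ (Eucl d)}

/-- A piecewise bubble function has a continuous representative which vanishes off the open
elements. -/
theorem exists_continuous_rep (hB : IsCellDecomposition Ω T B) {f : Finset (Eucl d) → Eucl d → ℂ}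
    (hf : ∀ K ∈ T, Continuous (f K)) {η : L2 Ω}
    (hη : ∀ K ∈ T, η =ᵐ[volume.restrict (openSimplex (B K))]
      fun x => (bubble (B K) Finset.univ x : ℂ) * f K x) :
    ∃ F : Eucl d → ℂ, Continuous F ∧ (∀ x ∉ Ω, F x = 0) ∧ η =ᵐ[volume.restrict Ω] F := by
  refine ⟨fun x => ∑ K ∈ T, (extBubble (B K) x : ℂ) * f K x, ?_, ?_, ?_⟩
  · exact continuous_finsetSum _ fun K hK =>
      (Complex.continuous_ofReal.comp (continuous_extBubble (B K))).mul (hf K hK)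
  · intro x hx
    refine Finset.sum_eq_zero fun K hK => ?_
    rw [extBubble_eq_zero _ fun h => hx (hB.subset K hK h)]
    simp
  · refine hB.ae_of_forall_cell fun K hK => ?_
    filter_upwards [hη K hK, ae_restrict_mem (isOpen_openSimplex (B K)).measurableSet] with x hx hxO
    rw [hx, Finset.sum_eq_single_of_mem K hK, extBubble_eq _ hxO]
    intro K' hK' hne
    rw [extBubble_eq_zero _
      (hB.notMem K hK K' hK' hne.symm x (hB.openSimplex_subset_cell hK hxO))]
    simp

/-- The element test functions assemble to elements of the discrete test space. -/
theorem mem_testSpace (hB : IsCellDecomposition Ω T B) (hΩ : IsOpen Ω)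
    (hb : Bornology.IsBounded Ω) {ΓD ΓR : Set (Eucl d)} (hR : ΓR ⊆ frontier Ω) (s : ℝ) {p : ℕ}
    {q : Finset (Eucl d) → MvPolynomial (Fin d) ℂ} (hq : ∀ K ∈ T, (q K).totalDegree ≤ p)
    {r : Finset (Eucl d) → Fin d → MvPolynomial (Fin d) ℂ}
    (hr : ∀ K ∈ T, ∀ m, (r K m).totalDegree ≤ p) {u : Finset (Eucl d) → Eucl d → CVec d}
    (hu : ∀ K ∈ T, u K = fun x => WithLp.toLp 2 fun m => polyEval (r K m) x)
    {η w : L2 Ω} {g v : L2Vec Ω}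
    (hη : ∀ K ∈ T, η =ᵐ[volume.restrict (openSimplex (B K))]
      fun x => (bubble (B K) Finset.univ x : ℂ) * polyEval (q K) x)
    (hg : ∀ K ∈ T, g =ᵐ[volume.restrict (openSimplex (B K))]
      gradC fun x => (bubble (B K) Finset.univ x : ℂ) * polyEval (q K) x)
    (hv : ∀ K ∈ T, v =ᵐ[volume.restrict (openSimplex (B K))] bubbleField (B K) (u K))
    (hw : ∀ K ∈ T, w =ᵐ[volume.restrict (openSimplex (B K))] bubbleFieldDiv (B K) (u K)) :
    (η, v) ∈ testSpace Ω ΓD ΓR s T p := by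
  have hus : ∀ K ∈ T, ∀ m, ContDiff ℝ ∞ fun x => u K x m := fun K hK m => by
    rw [hu K hK]
    exact contDiff_polyEval (r K m)
  have hgrad : HasWeakGrad η g := hB.hasWeakGrad_bubble (fun K _ => contDiff_polyEval (q K)) hη hg
  have hdiv : HasWeakDiv v w := hB.hasWeakDiv_bubbleField hus hv hw
  obtain ⟨F, hFc, hF0, hFη⟩ := hB.exists_continuous_rep
    (fun K _ => (contDiff_polyEval (q K) (n := 0)).continuous) hη
  have hzero : ∀ᵐ x ∂((surf d).restrict (frontier Ω)), (0 : L2Bdry Ω) x = 0 :=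
    Lp.coeFn_zero ℂ 2 _
  refine ⟨⟨⟨fun K hK => ?_, F, hFc.continuousOn, hFη⟩, ⟨w, hdiv⟩, fun K hK => ?_⟩,
    ⟨w, hdiv⟩, 0, ⟨⟨⟨g, hgrad⟩, fun _ => η, fun _ => F,
      fun _ => ⟨⟨g, hgrad⟩, hFc.continuousOn, hFη⟩, tendsto_const_nhds, tendsto_const_nhds, ?_⟩,
      hzero.mono fun x hx _ => hx⟩, fun ψ h hψ => ?_⟩
  · refine ⟨(∏ k, affinePoly ((B K).coord k)) * q K, ?_, hB.ae_cell_of_ae_restrict hK ?_⟩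
    · refine (MvPolynomial.totalDegree_mul _ _).trans ?_
      have h1 : (∏ k, affinePoly ((B K).coord k)).totalDegree ≤ d + 1 :=
        (MvPolynomial.totalDegree_finsetProd _ _).trans
          ((Finset.sum_le_sum fun k _ => totalDegree_affinePoly_le _).trans (by simp))
      have := hq K hK
      omega
    · filter_upwards [hη K hK] with x hx
      rw [hx, polyEval_prod_affinePoly]
      rfl
  · obtain ⟨Q, R, hQ, hRh, hQR⟩ := exists_raviartThomas_form (B K) (hr K hK) (hu K hK)
    refine ⟨Q, R, hQ, hRh, hB.ae_cell_of_ae_restrict hK ?_⟩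
    filter_upwards [hv K hK] with x hx i
    rw [hx, hQR]
  · have h0 : (fun x => F x - (0 : L2Bdry Ω) x) =ᵐ[(surf d).restrict (frontier Ω)] 0 := by
      filter_upwards [hzero, ae_restrict_mem isClosed_frontier.measurableSet] with x hx hxf
      rw [hx, hF0 x fun h => ?_]
      · simp
      · rw [hΩ.frontier_eq] at hxf
        exact hxf.2 h
    simp only [eLpNorm_congr_ae h0, eLpNorm_zero]
    exact tendsto_const_nhds
  · have h1 : normalPairing v ψ = 0 := hB.normalPairing_bubbleField hΩ hb hus hv hw hψ.1.1
    have h2 : ∫ x in ΓR, (0 : L2Bdry Ω) x * starRingEnd ℂ (h x) ∂(surf d) = 0 := by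
      rw [integral_eq_zero_of_ae]
      filter_upwards [ae_mono (Measure.restrict_mono_set (surf d) hR) hzero] with x hx
      rw [hx]
      simp
    rw [h1, h2]
    simp

end IsCellDecomposition

/-! ### The inf-sup bound -/

/-- `B_κ'` is the adjoint of `B_κ`, so the optimal test norm bounds the form by Cauchy-Schwarz. -/
theorem ultraWeakForm_eq_inner {Ω : Set (Eucl d)} (κ : ℝ) (w : USpace Ω) (z : L2 Ω × L2Vec Ω) :
    ultraWeakForm κ w z = inner ℂ (adjointOp κ z) w := by
  rw [WithLp.prod_inner_apply, L2.inner_def, L2.inner_def, ← integral_add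
    (L2.integrable_inner _ _) (L2.integrable_inner _ _), ultraWeakForm]
  refine integral_congr_ae ?_
  have h1 := Lp.coeFn_sub (-((κ : ℂ)⁻¹ • weakDiv z.2)) z.1
  have h2 := Lp.coeFn_neg ((κ : ℂ)⁻¹ • weakDiv z.2)
  have h3 := Lp.coeFn_smul ((κ : ℂ)⁻¹) (weakDiv z.2)
  have h4 := Lp.coeFn_sub ((κ : ℂ)⁻¹ • weakGrad z.1) z.2
  have h5 := Lp.coeFn_smul ((κ : ℂ)⁻¹) (weakGrad z.1)
  filter_upwards [h1, h2, h3, h4, h5] with x h1 h2 h3 h4 h5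
  simp only [adjointOp]
  rw [h1, h4, Pi.sub_apply, Pi.sub_apply, h2, h5, Pi.neg_apply, h3, Pi.smul_apply, Pi.smul_apply]
  have e1 : w.ofLp.1 = w.fst := rfl
  have e2 : w.ofLp.2 = w.snd := rfl
  simp only [e1, e2, inner_sub_left, inner_smul_left, RCLike.inner_apply, map_inv₀, map_sub,
    map_neg, map_mul, smul_eq_mul, Complex.conj_ofReal]
  ring

/-- The element size controls the minimal mesh size. -/
theorem hMin_le {ς : ℝ} {T : Finset (Finset (Eucl d))} (hd : 1 ≤ d) {K : Finset (Eucl d)}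
    (hK : K ∈ T) {x₀ : Eucl d} {ρ : ℝ} (hρ : 0 < ρ)
    (hball : Metric.closedBall x₀ (ρ / 2) ⊆ cell K) (hdiam : Metric.diam (cell K) ≤ ς * ρ) :
    hMin T ≤ ς * ρ * volume.real (Metric.ball (0 : Eucl d) 1) ^ (1 / (d : ℝ)) := by
  have hd0 : (d : ℝ) ≠ 0 := by
    exact_mod_cast (by omega : d ≠ 0)
  have hD : 0 ≤ ς * ρ := Metric.diam_nonneg.trans hdiam
  have hbdd : Bornology.IsBounded (cell K) := (K.finite_toSet.isCompact_convexHull ℝ).isBounded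
  have hx₀ : x₀ ∈ cell K := hball (Metric.mem_closedBall_self (by positivity))
  have hsub : cell K ⊆ Metric.closedBall x₀ (ς * ρ) := fun y hy =>
    Metric.mem_closedBall.2 ((Metric.dist_le_diam_of_mem hbdd hy hx₀).trans hdiam)
  have hvol : volume.real (cell K) ≤ (ς * ρ) ^ d * volume.real (Metric.ball (0 : Eucl d) 1) := by
    refine (measureReal_mono hsub (Metric.isBounded_closedBall.measure_lt_top).ne).trans
      (le_of_eq ?_)
    rw [measureReal_def, Measure.addHaar_closedBall volume x₀ hD, ENNReal.toReal_mul,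
      ENNReal.toReal_ofReal (by positivity), measureReal_def]
    simp
  have h1 : hMin T ≤ volume.real (cell K) ^ (1 / (d : ℝ)) := by
    refine ciInf_le ⟨0, ?_⟩ (⟨K, hK⟩ : {K : Finset (Eucl d) // K ∈ T})
    rintro _ ⟨K', rfl⟩
    exact Real.rpow_nonneg measureReal_nonneg _
  refine h1.trans ((Real.rpow_le_rpow measureReal_nonneg hvol (by positivity)).trans
    (le_of_eq ?_))
  rw [Real.mul_rpow (by positivity) measureReal_nonneg, ← Real.rpow_natCast, ← Real.rpow_mul hD,
    mul_one_div_cancel hd0, Real.rpow_one]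

/-- A small perturbation `X` does not spoil the coercivity of `Z` against `w`. -/
theorem le_norm_inner_div {E : Type*} [NormedAddCommGroup E] [InnerProductSpace ℂ E] {X Z w : E}
    {c M : ℝ} (hw : w ≠ 0) (hc : 0 < c) (hM : 0 ≤ M) (h1 : c * ‖w‖ ^ 2 ≤ (inner ℂ Z w).re)
    (h2 : ‖Z‖ ≤ M * ‖w‖) (h3 : ‖X‖ ≤ c / 2 * ‖w‖) :
    c / 2 / (M + c / 2) ≤ ‖inner ℂ (X - Z) w‖ / (‖w‖ * ‖X - Z‖) := by
  have hn : 0 < ‖w‖ := norm_pos_iff.2 hw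
  have h4 : c / 2 * ‖w‖ ^ 2 ≤ ‖inner ℂ (X - Z) w‖ := by
    have a1 : (inner ℂ Z w).re ≤ ‖inner ℂ Z w‖ := Complex.re_le_norm _
    have a2 : ‖inner ℂ X w‖ ≤ c / 2 * ‖w‖ * ‖w‖ :=
      (norm_inner_le_norm _ _).trans (mul_le_mul_of_nonneg_right h3 hn.le)
    have a3 : ‖inner ℂ Z w‖ - ‖inner ℂ X w‖ ≤ ‖inner ℂ (X - Z) w‖ := by
      rw [inner_sub_left, norm_sub_rev]
      exact norm_sub_norm_le _ _
    nlinarith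
  have h5 : ‖X - Z‖ ≤ (M + c / 2) * ‖w‖ := (norm_sub_le _ _).trans (by linarith)
  have h6 : 0 < ‖X - Z‖ := by
    by_contra h
    have h0 : ‖X - Z‖ = 0 := le_antisymm (not_lt.1 h) (norm_nonneg _)
    have := (norm_inner_le_norm (𝕜 := ℂ) (X - Z) w)
    rw [h0, zero_mul] at this
    have hpos : 0 < c / 2 * ‖w‖ ^ 2 := by positivity
    linarith
  rw [div_le_div_iff₀ (by positivity) (by positivity)]
  calc c / 2 * (‖w‖ * ‖X - Z‖) ≤ c / 2 * (‖w‖ * ((M + c / 2) * ‖w‖)) := by gcongr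
    _ = c / 2 * ‖w‖ ^ 2 * (M + c / 2) := by ring
    _ ≤ _ := by gcongr

theorem cdot_smul (t : ℝ) (u : CVec d) (e : Eucl d) : cdot ((t : ℂ) • u) e = t * cdot u e := by
  simp [cdot, Finset.mul_sum, mul_assoc]

theorem bubbleField_smul (B : AffineBasis (Fin (d + 1)) ℝ (Eucl d)) (t : ℝ) (u : Eucl d → CVec d)
    (x : Eucl d) : bubbleField B (fun y => (t : ℂ) • u y) x = (t : ℂ) • bubbleField B u x := by
  simp only [bubbleField, cdot_smul, Finset.smul_sum, smul_smul]
  refine Finset.sum_congr rfl fun i _ => Finset.sum_congr rfl fun j _ => ?_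
  rw [mul_left_comm]

theorem bubbleFieldDiv_smul (B : AffineBasis (Fin (d + 1)) ℝ (Eucl d)) (t : ℝ)
    {u : Eucl d → CVec d} (hu : ∀ m, ContDiff ℝ ∞ fun x => u x m) (x : Eucl d) :
    bubbleFieldDiv B (fun y => (t : ℂ) • u y) x = (t : ℂ) * bubbleFieldDiv B u x := by
  simp only [bubbleFieldDiv, cdot_smul, Finset.mul_sum]
  refine Finset.sum_congr rfl fun i _ => Finset.sum_congr rfl fun j _ => ?_
  have hd : DifferentiableAt ℝ (fun y => (bubble B {i, j} y : ℂ) * cdot (u y) (B i - B j)) x :=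
    (contDiff_bubble_smul B _ (contDiff_cdot hu _)).differentiable (by simp) x
  have he : (fun y => (bubble B {i, j} y : ℂ) * (t * cdot (u y) (B i - B j))) =
      fun y => (t : ℂ) * ((bubble B {i, j} y : ℂ) * cdot (u y) (B i - B j)) := by
    funext y
    ring
  rw [he, fderiv_const_mul hd]
  simp

theorem norm_sq_uSpace {Ω : Set (Eucl d)} (w : USpace Ω) : ‖w‖ ^ 2 = ‖w.fst‖ ^ 2 + ‖w.snd‖ ^ 2 :=
  WithLp.prod_norm_sq_eq_of_L2 w

/-- Every trial function `w` has a test pair `z = (η, v)` on which it is coercive, which it bounds in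
`U`, and whose first order terms `(-div v, ∇η)` it bounds up to the inverse of the mesh size. -/
theorem exists_test_pair (hd : 1 ≤ d) (p : ℕ) (ς : ℝ) :
    ∃ c M L : ℝ, 0 < c ∧ 0 ≤ M ∧ 0 ≤ L ∧
      ∀ (Ω ΓD ΓR : Set (Eucl d)), IsBoundedLipschitzDomain Ω → ΓR ⊆ frontier Ω →
      ∀ (T : Finset (Finset (Eucl d))), IsConformingMesh Ω T → IsShapeRegular ς T → 0 ≤ hMin T →
      ∀ (s : ℝ) (w : USpace Ω), w ∈ trialSpace Ω T p →
      ∃ z ∈ testSpace Ω ΓD ΓR s T p,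
        c * ‖w‖ ^ 2 ≤ (inner ℂ (WithLp.toLp 2 z) w).re ∧
        ‖(WithLp.toLp 2 z : USpace Ω)‖ ≤ M * ‖w‖ ∧
        hMin T * ‖(WithLp.toLp 2 (-weakDiv z.2, weakGrad z.1) : USpace Ω)‖ ≤ L * ‖w‖ := by
  classical
  obtain ⟨C, hC, hloc⟩ := exists_local_stability d p
  set β : ℝ := volume.real (Metric.ball (0 : Eucl d) 1) ^ (1 / (d : ℝ)) with hβ
  refine ⟨C⁻¹, √(1 + ((d + 1) ^ 2 * ς ^ 2) ^ 2), √((ς * β) ^ 2 * (C * (1 + ς ^ 2))),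
    by positivity, by positivity, by positivity, ?_⟩
  intro Ω ΓD ΓR hΩ hR T hT hreg hh s w hw
  obtain ⟨B, hB⟩ := exists_isCellDecomposition hΩ hT
  -- The trial function, element by element.
  have hφ : ∀ K, ∃ q : MvPolynomial (Fin d) ℂ, K ∈ T → q.totalDegree ≤ p ∧
      w.fst =ᵐ[volume.restrict (openSimplex (B K))] polyEval q := by
    intro K
    by_cases hK : K ∈ T
    · obtain ⟨q, hq, h⟩ := hw.1 K hK
      exact ⟨q, fun _ => ⟨hq, hB.ae_restrict_of_ae_cell hK h⟩⟩
    · exact ⟨0, fun h => absurd h hK⟩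
  have hu : ∀ K, ∃ r : Fin d → MvPolynomial (Fin d) ℂ, K ∈ T → (∀ m, (r m).totalDegree ≤ p) ∧
      w.snd =ᵐ[volume.restrict (openSimplex (B K))]
        fun x => WithLp.toLp 2 fun m => polyEval (r m) x := by
    intro K
    by_cases hK : K ∈ T
    · choose r hr h using fun m => hw.2 m K hK
      refine ⟨r, fun _ => ⟨hr, ?_⟩⟩
      have h' := ae_all_iff.2 fun m => hB.ae_restrict_of_ae_cell hK (h m)
      filter_upwards [h'] with x hx
      ext m
      exact hx m
    · exact ⟨0, fun h => absurd h hK⟩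
  choose q hq using hφ
  choose r hr using hu
  have hgeo : ∀ K, ∃ (x : Eucl d) (ρ : ℝ), 0 < ρ ∧ (K ∈ T →
      Metric.closedBall x (ρ / 2) ⊆ cell K ∧ Metric.diam (cell K) ≤ ς * ρ) := by
    intro K
    by_cases hK : K ∈ T
    · obtain ⟨x, ρ, hρ, h⟩ := hreg K hK
      exact ⟨x, ρ, hρ, fun _ => h⟩
    · exact ⟨0, 1, one_pos, fun h => absurd h hK⟩
  choose x₀ ρ hρ hball using hgeo
  let u : Finset (Eucl d) → Eucl d → CVec d := fun K x =>
    WithLp.toLp 2 fun m => polyEval (r K m) x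
  have hus : ∀ K m, ContDiff ℝ ∞ fun x => u K x m := fun K m => contDiff_polyEval (r K m)
  have huc : ∀ K, Continuous (u K) := fun K => (PiLp.continuous_toLp 2 _).comp
    (continuous_pi fun m => (contDiff_polyEval (r K m) (n := 0)).continuous)
  have hqc : ∀ K, Continuous (polyEval (q K)) := fun K =>
    (contDiff_polyEval (q K) (n := 0)).continuous
  have hest := fun K (hK : K ∈ T) => hloc (B K) (x₀ K) (ρ K) (ς * ρ K) (hρ K)
    (by rw [hB.range_eq K hK]; exact (hball K hK).1)
    (fun i j => (norm_edge_le (B K) i j).trans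
      (by rw [hB.range_eq K hK]; exact (hball K hK).2)) (q K) (r K) (hq K hK).1 (hr K hK).1
    (u K) rfl
  -- The scaling by `ρ⁻²` makes the field comparable to `u`.
  let t : Finset (Eucl d) → ℝ := fun K => (ρ K ^ 2)⁻¹
  have htρ : ∀ K, t K * ρ K ^ 2 = 1 := fun K => inv_mul_cancel₀ (pow_pos (hρ K) 2).ne'
  have ht0 : ∀ K, 0 < t K := fun K => inv_pos.2 (pow_pos (hρ K) 2)
  let u' : Finset (Eucl d) → Eucl d → CVec d := fun K x => (t K : ℂ) • u K x
  let f : Finset (Eucl d) → Eucl d → ℂ := fun K x =>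
    (bubble (B K) Finset.univ x : ℂ) * polyEval (q K) x
  have hfs : ∀ K, ContDiff ℝ ∞ (f K) := fun K =>
    contDiff_bubble_smul (B K) _ (contDiff_polyEval (q K))
  have hu's : ∀ K m, ContDiff ℝ ∞ fun x => u' K x m := fun K m =>
    contDiff_const.mul (hus K m)
  obtain ⟨η, hη⟩ := hB.exists_lp (f := f) fun K _ => (hfs K).continuous
  obtain ⟨g, hg⟩ := hB.exists_lp (f := fun K => gradC (f K)) fun K _ => continuous_gradC (hfs K)
  obtain ⟨v, hv⟩ := hB.exists_lp (f := fun K => bubbleField (B K) (u' K))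
    fun K _ => continuous_bubbleField _ (hu's K)
  obtain ⟨W, hW⟩ := hB.exists_lp (f := fun K => bubbleFieldDiv (B K) (u' K))
    fun K _ => continuous_bubbleFieldDiv _ (hu's K)
  have hgrad : weakGrad η = g :=
    (hB.hasWeakGrad_bubble (fun K _ => contDiff_polyEval (q K)) hη hg).weakGrad_eq
      hΩ.isOpen hΩ.isBounded
  have hdiv : weakDiv v = W :=
    (hB.hasWeakDiv_bubbleField (fun K _ => hu's K) hv hW).weakDiv_eq hΩ.isOpen hΩ.isBounded
  have hmem : (η, v) ∈ testSpace Ω ΓD ΓR s T p := by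
    refine hB.mem_testSpace hΩ.isOpen hΩ.isBounded hR s (fun K hK => (hq K hK).1)
      (r := fun K m => MvPolynomial.C (t K : ℂ) * r K m) (fun K hK m => ?_) (fun K hK => ?_)
      hη hg hv hW
    · exact (MvPolynomial.totalDegree_mul _ _).trans (by simpa using (hr K hK).1 m)
    · funext x
      ext m
      simp [u', u, polyEval]
  -- Elementwise norms.
  let N₁ : Finset (Eucl d) → ℝ := fun K => ∫ x in openSimplex (B K), ‖polyEval (q K) x‖ ^ 2
  let N₂ : Finset (Eucl d) → ℝ := fun K => ∫ x in openSimplex (B K), ‖u K x‖ ^ 2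
  have hN₁ : ∀ K, 0 ≤ N₁ K := fun K => integral_nonneg fun x => by positivity
  have hN₂ : ∀ K, 0 ≤ N₂ K := fun K => integral_nonneg fun x => by positivity
  have hwn : ‖w‖ ^ 2 = ∑ K ∈ T, (N₁ K + N₂ K) := by
    rw [norm_sq_uSpace, hB.norm_sq_lp (fun K _ => hqc K) fun K hK => (hq K hK).2,
      hB.norm_sq_lp (fun K _ => huc K) fun K hK => (hr K hK).2, Finset.sum_add_distrib]
  have hmono : ∀ K, ∀ {a b : Eucl d → ℝ}, Continuous a → Continuous b →
      (∀ x ∈ openSimplex (B K), a x ≤ b x) →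
      ∫ x in openSimplex (B K), a x ≤ ∫ x in openSimplex (B K), b x := fun K a b ha hb hab =>
    setIntegral_mono_on (integrableOn_openSimplex _ ha) (integrableOn_openSimplex _ hb)
      (isOpen_openSimplex (B K)).measurableSet hab
  refine ⟨(η, v), hmem, ?_, ?_, ?_⟩
  · have hin : (inner ℂ (WithLp.toLp 2 (η, v) : USpace Ω) w) = ((∑ K ∈ T,
        ((∫ x in openSimplex (B K), bubble (B K) Finset.univ x * ‖polyEval (q K) x‖ ^ 2) +
        t K * ∫ x in openSimplex (B K), ∑ i, ∑ j,
          bubble (B K) {i, j} x * ‖cdot (u K x) (B K i - B K j)‖ ^ 2) : ℝ) : ℂ) := by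
      rw [WithLp.prod_inner_apply]
      change inner ℂ η w.fst + inner ℂ v w.snd = _
      rw [hB.inner_lp (fun K _ => (hfs K).continuous) (fun K _ => hqc K) hη
          fun K hK => (hq K hK).2,
        hB.inner_lp (fun K _ => continuous_bubbleField _ (hu's K)) (fun K _ => huc K) hv
          fun K hK => (hr K hK).2, ← Finset.sum_add_distrib]
      push_cast
      refine Finset.sum_congr rfl fun K _ => ?_
      congr 1
      · rw [← integral_complex_ofReal]
        refine integral_congr_ae (ae_of_all _ fun x => ?_)
        simp only [f, RCLike.inner_apply, map_mul, Complex.conj_ofReal]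
        push_cast
        rw [← Complex.mul_conj']
        ring
      · rw [← integral_complex_ofReal, ← integral_const_mul]
        refine integral_congr_ae (ae_of_all _ fun x => ?_)
        simp only [u']
        rw [bubbleField_smul, inner_smul_left, Complex.conj_ofReal, inner_bubbleField]
    rw [hin, Complex.ofReal_re, hwn, Finset.mul_sum]
    refine Finset.sum_le_sum fun K hK => ?_
    obtain ⟨h1, h2, -, -⟩ := hest K hK
    rw [mul_add]
    refine add_le_add ((inv_mul_le_iff₀ hC).2 h1) ((inv_mul_le_iff₀ hC).2 ?_)
    calc N₂ K = t K * (ρ K ^ 2 * N₂ K) := by rw [← mul_assoc, htρ, one_mul]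
      _ ≤ t K * (C * _) := mul_le_mul_of_nonneg_left h2 (ht0 K).le
      _ = _ := by ring
  · refine le_of_sq_le_sq ?_ (by positivity)
    rw [mul_pow, Real.sq_sqrt (by positivity), norm_sq_uSpace, hwn]
    change ‖η‖ ^ 2 + ‖v‖ ^ 2 ≤ _
    rw [hB.norm_sq_lp (fun K _ => (hfs K).continuous) hη,
      hB.norm_sq_lp (fun K _ => continuous_bubbleField _ (hu's K)) hv, ← Finset.sum_add_distrib,
      Finset.mul_sum]
    refine Finset.sum_le_sum fun K hK => ?_
    have h1 : ∫ x in openSimplex (B K), ‖f K x‖ ^ 2 ≤ N₁ K := by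
      refine hmono K ((hfs K).continuous.norm.pow 2) ((hqc K).norm.pow 2) fun x hx => ?_
      refine pow_le_pow_left₀ (norm_nonneg _) ?_ 2
      simp only [f]
      rw [norm_mul, Complex.norm_real, Real.norm_eq_abs, abs_of_pos (bubble_pos _ hx _)]
      exact mul_le_of_le_one_left (norm_nonneg _) (bubble_le_one _ hx _)
    have h2 : ∫ x in openSimplex (B K), ‖bubbleField (B K) (u' K) x‖ ^ 2 ≤
        ((d + 1) ^ 2 * ς ^ 2) ^ 2 * N₂ K := by
      simp only [N₂]
      rw [← integral_const_mul]
      refine hmono K ((continuous_bubbleField _ (hu's K)).norm.pow 2)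
        (((huc K).norm.pow 2).const_mul _) fun x hx => ?_
      rw [← mul_pow]
      refine pow_le_pow_left₀ (norm_nonneg _) ?_ 2
      simp only [u']
      rw [bubbleField_smul, norm_smul, Complex.norm_real, Real.norm_eq_abs, abs_of_pos (ht0 K)]
      have h3 := norm_bubbleField_le (B K) (u K) (D := ς * ρ K)
        (fun i j => (norm_edge_le (B K) i j).trans
          (by rw [hB.range_eq K hK]; exact (hball K hK).2)) hx
      calc _ ≤ t K * ((d + 1) ^ 2 * (ς * ρ K) ^ 2 * ‖u K x‖) :=
            mul_le_mul_of_nonneg_left h3 (ht0 K).le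
        _ = (t K * ρ K ^ 2) * ((d + 1) ^ 2 * ς ^ 2 * ‖u K x‖) := by ring
        _ = _ := by rw [htρ, one_mul]
    have hsq : 0 ≤ ((d + 1 : ℝ) ^ 2 * ς ^ 2) ^ 2 := sq_nonneg _
    nlinarith [hN₁ K, hN₂ K, mul_nonneg hsq (hN₁ K)]
  · refine le_of_sq_le_sq ?_ (by positivity)
    rw [mul_pow, mul_pow, Real.sq_sqrt (by positivity), norm_sq_uSpace, hwn]
    change hMin T ^ 2 * (‖-weakDiv v‖ ^ 2 + ‖weakGrad η‖ ^ 2) ≤ _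
    rw [hgrad, hdiv, norm_neg, hB.norm_sq_lp (fun K _ => continuous_bubbleFieldDiv _ (hu's K)) hW,
      hB.norm_sq_lp (fun K _ => continuous_gradC (hfs K)) hg, ← Finset.sum_add_distrib,
      Finset.mul_sum, Finset.mul_sum]
    refine Finset.sum_le_sum fun K hK => ?_
    obtain ⟨-, -, h3, h4⟩ := hest K hK
    have hmin : hMin T ^ 2 ≤ (ς * β) ^ 2 * ρ K ^ 2 := by
      have := hMin_le hd hK (hρ K) (hball K hK).1 (hball K hK).2
      calc hMin T ^ 2 ≤ (ς * ρ K * β) ^ 2 := pow_le_pow_left₀ hh this 2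
        _ = _ := by ring
    have h5 : ∫ x in openSimplex (B K), ‖bubbleFieldDiv (B K) (u' K) x‖ ^ 2 =
        t K ^ 2 * ∫ x in openSimplex (B K), ‖bubbleFieldDiv (B K) (u K) x‖ ^ 2 := by
      rw [← integral_const_mul]
      refine integral_congr_ae (ae_of_all _ fun x => ?_)
      simp only [u']
      rw [bubbleFieldDiv_smul _ _ (hus K), norm_mul, Complex.norm_real, Real.norm_eq_abs,
        abs_of_pos (ht0 K), mul_pow]
    rw [h5]
    have hg0 : 0 ≤ ∫ x in openSimplex (B K), ‖gradC (f K) x‖ ^ 2 :=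
      integral_nonneg fun x => by positivity
    have hw0 : 0 ≤ ∫ x in openSimplex (B K), ‖bubbleFieldDiv (B K) (u K) x‖ ^ 2 :=
      integral_nonneg fun x => by positivity
    calc _ ≤ ((ς * β) ^ 2 * ρ K ^ 2) *
          (t K ^ 2 * (∫ x in openSimplex (B K), ‖bubbleFieldDiv (B K) (u K) x‖ ^ 2) +
            ∫ x in openSimplex (B K), ‖gradC (f K) x‖ ^ 2) := by gcongr
      _ = (ς * β) ^ 2 * ((t K * ρ K ^ 2) * t K *
            (∫ x in openSimplex (B K), ‖bubbleFieldDiv (B K) (u K) x‖ ^ 2) +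
            ρ K ^ 2 * ∫ x in openSimplex (B K), ‖gradC (f K) x‖ ^ 2) := by ring
      _ ≤ (ς * β) ^ 2 * ((t K * ρ K ^ 2) * t K * (C * (ς * ρ K) ^ 2 * N₂ K) + C * N₁ K) := by
          have := ht0 K
          gcongr
      _ = (ς * β) ^ 2 * ((t K * ρ K ^ 2) * (t K * ρ K ^ 2) * (C * ς ^ 2 * N₂ K) + C * N₁ K) := by
          ring
      _ = (ς * β) ^ 2 * (C * ς ^ 2 * N₂ K + C * N₁ K) := by rw [htρ]; ring
      _ ≤ (ς * β) ^ 2 * (C * (1 + ς ^ 2) * (N₁ K + N₂ K)) := by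
          refine mul_le_mul_of_nonneg_left ?_ (sq_nonneg _)
          have e1 : 0 ≤ C * N₂ K := mul_nonneg hC.le (hN₂ K)
          have e2 : 0 ≤ C * ς ^ 2 * N₁ K :=
            mul_nonneg (mul_nonneg hC.le (sq_nonneg _)) (hN₁ K)
          nlinarith
      _ = _ := by ring

/-- The trial space contains the constant function `(1, 0)`. -/
theorem exists_mem_trialSpace_ne_zero {Ω : Set (Eucl d)} {T : Finset (Finset (Eucl d))} (p : ℕ)
    (hΩ : IsBoundedLipschitzDomain Ω) : ∃ w ∈ trialSpace Ω T p, w ≠ 0 := by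
  have : IsFiniteMeasure (volume.restrict Ω) :=
    ⟨by simpa using hΩ.isBounded.measure_lt_top⟩
  let φ : L2 Ω := (memLp_const (1 : ℂ)).toLp fun _ => (1 : ℂ)
  have hφ : φ =ᵐ[volume.restrict Ω] fun _ => (1 : ℂ) := MemLp.coeFn_toLp _
  refine ⟨WithLp.toLp 2 (φ, 0), ⟨fun K _ => ⟨1, by simp, ?_⟩, fun i K _ => ⟨0, by simp, ?_⟩⟩, ?_⟩
  · filter_upwards [hφ] with x hx _
    change φ x = _
    rw [hx]
    simp [polyEval]
  · filter_upwards [Lp.coeFn_zero (CVec d) 2 (volume.restrict Ω)] with x hx _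
    change (0 : L2Vec Ω) x i = _
    rw [hx]
    simp [polyEval]
  · intro h
    have h0 : φ = 0 := congrArg (fun w : USpace Ω => w.fst) h
    have h1 := (Lp.eq_zero_iff_ae_eq_zero).1 h0
    have h2 : ∀ᵐ x ∂(volume.restrict Ω), False := by
      filter_upwards [hφ, h1] with x hx hx'
      rw [hx] at hx'
      exact one_ne_zero hx'
    rw [ae_iff] at h2
    have h3 : volume Ω = 0 := by simpa using h2
    exact (hΩ.isOpen.measure_pos volume hΩ.isConnected.nonempty).ne' h3

/-- To bound the inf-sup constant, one good test function for each trial function suffices. -/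
theorem le_infSupConst {Ω : Set (Eucl d)} {κ c : ℝ} {U : Set (USpace Ω)}
    {V : Set (L2 Ω × L2Vec Ω)} (hU : ∃ w ∈ U, w ≠ 0)
    (h : ∀ w ∈ U, w ≠ 0 → ∃ z ∈ V, z ≠ 0 ∧
      c ≤ ‖inner ℂ (adjointOp κ z) w‖ / (‖w‖ * ‖adjointOp κ z‖)) :
    c ≤ infSupConst κ U V := by
  obtain ⟨w₀, hw₀, hne⟩ := hU
  -- The infimum over an empty set of trial functions would be `0`.
  have : Nonempty {w : USpace Ω // w ∈ U ∧ w ≠ 0} := ⟨⟨w₀, hw₀, hne⟩⟩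
  refine le_ciInf fun w => ?_
  obtain ⟨z, hz, hz0, hc⟩ := h w.1 w.2.1 w.2.2
  rw [← ultraWeakForm_eq_inner] at hc
  -- The quotients are at most `1`, so the supremum is not a junk value.
  refine le_ciSup_of_le ⟨1, ?_⟩ ⟨z, hz, hz0⟩ hc
  rintro _ ⟨z', rfl⟩
  refine div_le_one_of_le₀ ?_ (mul_nonneg (norm_nonneg _) (norm_nonneg _))
  rw [ultraWeakForm_eq_inner, mul_comm]
  exact norm_inner_le_norm _ _

end Helmholtz

theorem theorem5p1 (d : ℕ) (hd : 1 ≤ d) (p : ℕ) (ς : ℝ) :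
    ∃ C : ℝ, 0 < C ∧ ∃ c : ℝ, 0 < c ∧
      ∀ (Ω ΓD ΓN ΓR : Set (Eucl d)),
        IsBoundedLipschitzDomain Ω → IsBoundaryDecomposition Ω ΓD ΓN ΓR →
      ∀ (T : Finset (Finset (Eucl d))), IsConformingMesh Ω T → IsShapeRegular ς T →
      ∀ (s : ℝ), (s = 1 ∨ s = -1) →
      ∀ (κ : ℝ), 0 < κ → C ≤ κ * hMin T →
        c ≤ infSupConst κ (trialSpace Ω T p) (testSpace Ω ΓD ΓR s T p) := by
  obtain ⟨c, M, L, hc, hM, hL, hmain⟩ := exists_test_pair hd p ς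
  refine ⟨2 * L / c + 1, by positivity, c / 2 / (M + c / 2), by positivity, ?_⟩
  intro Ω ΓD ΓN ΓR hΩ hΓ T hT hreg s _ κ hκ hκh
  have hpos : 0 < κ * hMin T := lt_of_lt_of_le (by positivity) hκh
  have hh : 0 < hMin T := pos_of_mul_pos_right hpos hκ.le
  have hR : ΓR ⊆ frontier Ω := by
    rw [← hΓ.union_eq]
    exact Set.subset_union_right
  refine le_infSupConst (exists_mem_trialSpace_ne_zero p hΩ) fun w hw hw0 => ?_
  obtain ⟨z, hz, h1, h2, h3⟩ := hmain Ω ΓD ΓR hΩ hR T hT hreg hh.le s w hw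
  refine ⟨z, hz, ?_, ?_⟩
  · rintro rfl
    have h0 : (WithLp.toLp 2 (0 : L2 Ω × L2Vec Ω) : USpace Ω) = 0 := rfl
    rw [h0, inner_zero_left, Complex.zero_re] at h1
    have : 0 < c * ‖w‖ ^ 2 := mul_pos hc (pow_pos (norm_pos_iff.2 hw0) 2)
    linarith
  · have hadj : adjointOp κ z = (κ : ℂ)⁻¹ • (WithLp.toLp 2 (-weakDiv z.2, weakGrad z.1) : USpace Ω)
        - WithLp.toLp 2 z := by
      rw [← WithLp.toLp_smul, ← WithLp.toLp_sub, adjointOp]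
      congr 1
      ext1
      · simp [smul_neg]
      · simp
    rw [hadj]
    refine le_norm_inner_div hw0 hc hM h1 h2 ?_
    rw [norm_smul, norm_inv, Complex.norm_real, Real.norm_eq_abs, abs_of_pos hκ]
    -- `κ⁻¹ L / h ≤ c / 2` is what the condition on `κ h` is made for.
    rw [inv_mul_le_iff₀ hκ]
    have h4 : L ≤ c / 2 * (κ * hMin T) := by
      have : 2 * L / c ≤ κ * hMin T := by linarith
      rw [div_le_iff₀ hc] at this
      linarith
    refine le_of_mul_le_mul_left ?_ hh
    calc _ ≤ L * ‖w‖ := h3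
      _ ≤ c / 2 * (κ * hMin T) * ‖w‖ := mul_le_mul_of_nonneg_right h4 (norm_nonneg _)
      _ = _ := by ring
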